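/- Let $\mathbb K$ be an algebraically closed field of characteristic different from $2$, let $d\ge 0$ be an integer, let $q\in\mathbb K$ be nonzero and not a root of unity, put $\beta=q^2+q^{-2}$, and let $\sqrt{-1}\in\mathbb K$ be a fixed square root of $-1$. A square matrix is *irreducible tridiagonal* if its nonzero entries lie only on the main diagonal, the superdiagonal and the subdiagonal, and all entries on the superdiagonal and the subdiagonal are nonzero. A *Leonard pair* on a $\mathbb K$-vector space $V$ of finite positive dimension is an ordered pair $(A,A^*)$ of linear maps $V\to V$ such that in some basis of $V$ the matrix of $A^*$ is diagonal and that of $A$ is irreducible tridiagonal, and in some basis of $V$ the matrix of $A$ is diagonal and that of $A^*$ is irreducible tridiagonal. Pairs $(A,A^*)$ on $V$ and $(B,B^*)$ on $W$ are *isomorphic* if there is a linear isomorphism $\sigma:V\to W$ with $\sigma A\sigma^{-1}=B$ and $\sigma A^*\sigma^{-1}=B^*$. The relations $AW(\beta,\gamma,\gamma^*,\varrho,\varrho^*,\omega,\eta,\eta^*)$ are $$A^2A^*-\beta AA^*A+A^*A^2-\gamma(AA^*+A^*A)-\varrho A^*=\gamma^*A^2+\omega A+\eta I,$$ $$A^{*2}A-\beta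 A^*AA^*+AA^{*2}-\gamma^*(A^*A+AA^*)-\varrho^*A=\gamma A^{*2}+\omega A^*+\eta^*I.$$ Define $(d+1)\times(d+1)$ matrices, with rows and columns indexed by $0,\dots,d$, as follows (entries not mentioned are zero): * $A_1$ is tridiagonal with zero diagonal, $(j,j+1)$-entry $\sqrt{-1}\,\dfrac{q^{2d-2j}-q^{2j-2d}}{q^{d-2j}+q^{2j-d}}$ for $0\le j\le d-1$, and $(j,j-1)$-entry $\sqrt{-1}\,\dfrac{q^{2j}-q^{-2j}}{q^{d-2j}+q^{2j-d}}$ for $1\le j\le d$. * $A_1^*$ is diagonal with $(j,j)$-entry $\sqrt{-1}\,(q^{d-2j}-q^{2j-d})$ for $0\le j\le d$. * $A_2$ is tridiagonal with $(0,0)$-entry $\dfrac{q^{2d+2}-q^{-2d-2}}{q-q^{-1}}$, all other diagonal entries zero, $(j,j+1)$-entry $\dfrac{q^{2d-2j}-q^{2j-2d}}{q^{-2j-1}-q^{2j+1}}$ for $0\le j\le d-1$, and $(j,j-1)$-entry $\dfrac{q^{2d+2j+2}-q^{-2d-2j-2}}{q^{2j+1}-q^{-2j-1}}$ for $1\le j\le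 d$. * $A_2^*$ is diagonal with $(j,j)$-entry $q^{2j+1}+q^{-2j-1}$ for $0\le j\le d$. Then the five pairs $$(A_1,A_1^*),\quad (A_2,A_2^*),\quad (A_2,-A_2^*),\quad (-A_2,A_2^*),\quad (-A_2,-A_2^*)$$ are pairwise non-isomorphic Leonard pairs on $\mathbb K^{d+1}$, all satisfying the same relations $AW(\beta,0,0,4-\beta^2,4-\beta^2,0,0,0)$, and every Leonard pair on a $(d+1)$-dimensional $\mathbb K$-vector space that satisfies these relations is isomorphic to one of them. Moreover $(A_1,A_1^*)$ and $(A_2,A_2^*)$ are self-dual, that is, $(A_i,A_i^*)$ is isomorphic to $(A_i^*,A_i)$ for $i=1,2$, and the pairs $(A_1,-A_1^*)$, $(-A_1,A_1^*)$, $(-A_1,-A_1^*)$ are isomorphic to $(A_1,A_1^*)$. -/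

import Mathlib

/-- A square matrix is irreducible tridiagonal if its entries vanish off the main diagonal, the
superdiagonal and the subdiagonal, and all entries on the superdiagonal and on the subdiagonal
are nonzero. -/
def IsIrreducibleTridiagonal {K : Type*} [Field K] {n : ℕ} (M : Matrix (Fin n) (Fin n) K) : Prop :=
  (∀ i j : Fin n, (i : ℕ) + 1 < j ∨ (j : ℕ) + 1 < i → M i j = 0) ∧
  (∀ i j : Fin n, (i : ℕ) + 1 = j → M i j ≠ 0 ∧ M j i ≠ 0)

/-- `(A, As)` is a Leonard pair on `V`: in some basis `As` is diagonal and `A` is irreducible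
tridiagonal, and in some basis `A` is diagonal and `As` is irreducible tridiagonal. A basis
indexed by `Fin (d + 1)` forces `V` to have finite positive dimension. -/
structure IsLeonardPair {K V : Type*} [Field K] [AddCommGroup V] [Module K V]
    (A As : Module.End K V) : Prop where
  tridiagonal_diagonal : ∃ (d : ℕ) (b : Module.Basis (Fin (d + 1)) K V),
    IsIrreducibleTridiagonal (LinearMap.toMatrix b b A) ∧ (LinearMap.toMatrix b b As).IsDiag
  diagonal_tridiagonal : ∃ (d : ℕ) (b : Module.Basis (Fin (d + 1)) K V),
    (LinearMap.toMatrix b b A).IsDiag ∧ IsIrreducibleTridiagonal (LinearMap.toMatrix b b As)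

/-- The pairs `(A, As)` on `V` and `(B, Bs)` on `W` are isomorphic: some linear isomorphism
`σ : V → W` satisfies `σ A σ⁻¹ = B` and `σ As σ⁻¹ = Bs`. -/
def PairIsomorphic {K V W : Type*} [Field K] [AddCommGroup V] [Module K V]
    [AddCommGroup W] [Module K W] (A As : Module.End K V) (B Bs : Module.End K W) : Prop :=
  ∃ σ : V ≃ₗ[K] W, σ.conj A = B ∧ σ.conj As = Bs

/-- `(A, As)` satisfies the Askey-Wilson relations `AW(β, γ, γs, ρ, ρs, ω, η, ηs)`. -/
def SatisfiesAW {K V : Type*} [Field K] [AddCommGroup V] [Module K V]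
    (β γ γs ρ ρs ω η ηs : K) (A As : Module.End K V) : Prop :=
  A ^ 2 * As - β • (A * As * A) + As * A ^ 2 - γ • (A * As + As * A) - ρ • As
    = γs • A ^ 2 + ω • A + η • (1 : Module.End K V) ∧
  As ^ 2 * A - β • (As * A * As) + A * As ^ 2 - γs • (As * A + A * As) - ρs • A
    = γ • As ^ 2 + ω • As + ηs • (1 : Module.End K V)

/-- The matrix `A₁`; `r` is the chosen square root of `-1`. The superdiagonal entry in row `j`
(`0 ≤ j ≤ d - 1`) and the subdiagonal entry in row `j` (`1 ≤ j ≤ d`) are as displayed. -/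
def matA₁ {K : Type*} [Field K] (d : ℕ) (q r : K) : Matrix (Fin (d + 1)) (Fin (d + 1)) K :=
  Matrix.of fun j k =>
    if (k : ℕ) = j + 1 then
      r * ((q ^ (2 * (d : ℤ) - 2 * (j : ℕ)) - q ^ (2 * (j : ℕ) - 2 * (d : ℤ))) /
        (q ^ ((d : ℤ) - 2 * (j : ℕ)) + q ^ (2 * (j : ℕ) - (d : ℤ))))
    else if (j : ℕ) = k + 1 then
      r * ((q ^ (2 * ((j : ℕ) : ℤ)) - q ^ (-2 * ((j : ℕ) : ℤ))) /
        (q ^ ((d : ℤ) - 2 * (j : ℕ)) + q ^ (2 * (j : ℕ) - (d : ℤ))))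
    else 0

/-- The diagonal matrix `A₁*`. -/
def matA₁s {K : Type*} [Field K] (d : ℕ) (q r : K) : Matrix (Fin (d + 1)) (Fin (d + 1)) K :=
  Matrix.diagonal fun j =>
    r * (q ^ ((d : ℤ) - 2 * (j : ℕ)) - q ^ (2 * (j : ℕ) - (d : ℤ)))

/-- The tridiagonal matrix `A₂`, whose only nonzero diagonal entry is the upper-left one. -/
def matA₂ {K : Type*} [Field K] (d : ℕ) (q : K) : Matrix (Fin (d + 1)) (Fin (d + 1)) K :=
  Matrix.of fun j k =>
    if (j : ℕ) = 0 ∧ (k : ℕ) = 0 then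
      (q ^ (2 * (d : ℤ) + 2) - q ^ (-2 * (d : ℤ) - 2)) / (q - q⁻¹)
    else if (k : ℕ) = j + 1 then
      (q ^ (2 * (d : ℤ) - 2 * (j : ℕ)) - q ^ (2 * (j : ℕ) - 2 * (d : ℤ))) /
        (q ^ (-2 * ((j : ℕ) : ℤ) - 1) - q ^ (2 * ((j : ℕ) : ℤ) + 1))
    else if (j : ℕ) = k + 1 then
      (q ^ (2 * (d : ℤ) + 2 * (j : ℕ) + 2) - q ^ (-2 * (d : ℤ) - 2 * (j : ℕ) - 2)) /
        (q ^ (2 * ((j : ℕ) : ℤ) + 1) - q ^ (-2 * ((j : ℕ) : ℤ) - 1))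
    else 0

/-- The diagonal matrix `A₂*`. -/
def matA₂s {K : Type*} [Field K] (d : ℕ) (q : K) : Matrix (Fin (d + 1)) (Fin (d + 1)) K :=
  Matrix.diagonal fun j => q ^ (2 * ((j : ℕ) : ℤ) + 1) + q ^ (-2 * ((j : ℕ) : ℤ) - 1)

/-- The five matrix pairs
`(A₁, A₁*)`, `(A₂, A₂*)`, `(A₂, -A₂*)`, `(-A₂, A₂*)`, `(-A₂, -A₂*)`. -/
def fivePairs {K : Type*} [Field K] (d : ℕ) (q r : K) : Fin 5 →
    Matrix (Fin (d + 1)) (Fin (d + 1)) K × Matrix (Fin (d + 1)) (Fin (d + 1)) K :=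
  ![(matA₁ d q r, matA₁s d q r), (matA₂ d q, matA₂s d q), (matA₂ d q, -matA₂s d q),
    (-matA₂ d q, matA₂s d q), (-matA₂ d q, -matA₂s d q)]

/-! In a basis where `As` is diagonal with eigenvalues θ_j and `A` is irreducible tridiagonal with
diagonal a_j, put ρ = 4 - β². Compared entry by entry, the relations contain θ_j + θ_{j+2} = β
θ_{j+1}, θ_j² - β θ_j θ_{j+1} + θ_{j+1}² = ρ, a_j ((2 - β) θ_j² - ρ) = 0, and an equation linking
consecutive products of opposite off-diagonal entries of `A`.

For d > 0 the first two give θ_j = t_j + t_j⁻¹ with t_j = u q^{2j} (`exists_string`). A nonzero a_j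
forces t_j² = q^{±2}, and then θ_j coincides with a neighbouring value of the string. The
eigenvalues are distinct, so that neighbour lies outside the range: the diagonal of `A` is zero or
has one nonzero entry, at an end. The equation for the products, multiplied by t_j - t_j⁻¹,
telescopes (`stringDiff_mul_diagonal`), and the products vanish beyond both ends. With zero diagonal
this forces u² q^{2d} = ±1; the sign + gives θ_0 = θ_d, and the sign - gives the first pair. With a
corner entry, reversing the basis if necessary makes u = ±q, and the square of the corner entry is
determined; the two signs make four pairs. Rescaling the basis shows that the diagonals and the
products determine the pair (`pairIsomorphic_of_products`).

Conversely, the models satisfy the relations by the same computation, and an eigenbasis for `A` must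
be found. The all-ones vector v and `As` v are eigenvectors of `A`. On an eigenvector w whose
eigenvalue lies in a string, the first relation says that (A - x)(A - z) kills `As` w, where x and z
are the neighbouring values. Applying `As` thus generates eigenvectors of `A`; as V has no proper
nonzero subspace invariant under both maps, enough of them are nonzero and `As` is irreducible
tridiagonal on them (`isLeonardPair_of_eigenString`).

The pairs of traces are (0, 0) and (±T, ±T) with T ≠ 0, which separates the five pairs. Exchanging
the two maps or changing signs preserves the Leonard property and the relations, so the result is
again one of the five and its traces tell which. Self-duality and the sign symmetries therefore need
no explicit intertwiner. -/

/-! ### Irreducible tridiagonal maps and strings of eigenvectors -/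

section LinearAlgebra

open Module

variable {K V : Type*} [Field K] [AddCommGroup V] [Module K V] {d : ℕ}

/-- An eigenvector of an irreducible tridiagonal map vanishes once its first coordinate does. -/
theorem eq_zero_of_repr_zero_eq_zero {b : Basis (Fin (d + 1)) K V} {A : End K V}
    (hA : IsIrreducibleTridiagonal (LinearMap.toMatrix b b A)) {θ : K} {v : V}
    (hv : A v = θ • v) (h0 : b.repr v 0 = 0) : v = 0 := by
  have key : ∀ n : ℕ, ∀ i : Fin (d + 1), (i : ℕ) ≤ n → b.repr v i = 0 := by
    intro n
    induction n with
    | zero =>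
      intro i hi
      have : i = 0 := Fin.ext (by simpa using hi)
      rw [this, h0]
    | succ n ih =>
      intro i hi
      rcases Nat.lt_or_ge (i : ℕ) (n + 1) with h | h
      · exact ih i (by omega)
      have hi' : (i : ℕ) = n + 1 := by omega
      let k : Fin (d + 1) := ⟨n, by omega⟩
      have hk : (k : ℕ) + 1 = i := hi'.symm
      -- In row n of A v = θ v the only term not yet known to vanish is the superdiagonal entry
      -- times coordinate n + 1.
      have hrow : (LinearMap.toMatrix b b A).mulVec (b.repr v) k = b.repr (A v) k := by
        rw [LinearMap.toMatrix_mulVec_repr]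
      rw [hv, map_smul, Finsupp.smul_apply, ih k le_rfl, smul_zero, Matrix.mulVec, dotProduct,
        Finset.sum_eq_single i] at hrow
      · exact (mul_eq_zero.mp hrow).resolve_left (hA.2 k i hk).1
      · intro j _ hj
        rcases Nat.lt_or_ge (j : ℕ) (n + 1) with h' | h'
        · rw [ih j (by omega), mul_zero]
        · have : (j : ℕ) ≠ i := fun h => hj (Fin.ext h)
          rw [hA.1 k j (Or.inl (by simp only [k]; omega)), zero_mul]
      · simp
  refine b.repr.map_eq_zero_iff.mp (Finsupp.ext fun i => ?_)
  exact key i i le_rfl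

/-- Subtracting from `w` the multiple of `v` with the same first coordinate leaves an eigenvector
with first coordinate zero. -/
theorem exists_smul_eq_of_eigenvector {b : Basis (Fin (d + 1)) K V} {A : End K V}
    (hA : IsIrreducibleTridiagonal (LinearMap.toMatrix b b A)) {θ : K} {v w : V}
    (hv : A v = θ • v) (hw : A w = θ • w) (hv0 : v ≠ 0) : ∃ c : K, w = c • v := by
  have h0 : b.repr v 0 ≠ 0 := fun h => hv0 (eq_zero_of_repr_zero_eq_zero hA hv h)
  refine ⟨b.repr w 0 / b.repr v 0, sub_eq_zero.mp
    (eq_zero_of_repr_zero_eq_zero (θ := θ) hA ?_ ?_)⟩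
  · rw [map_sub, map_smul, hv, hw, smul_sub, smul_comm]
  · simp [h0]

theorem apply_basis_of_isDiag {b : Basis (Fin (d + 1)) K V} {A : End K V}
    (h : (LinearMap.toMatrix b b A).IsDiag) (j : Fin (d + 1)) :
    A (b j) = LinearMap.toMatrix b b A j j • b j := by
  rw [← b.sum_repr (A (b j)), Finset.sum_eq_single j]
  · rw [LinearMap.toMatrix_apply]
  · intro i _ hi
    have h0 : LinearMap.toMatrix b b A i j = 0 := h hi
    rw [LinearMap.toMatrix_apply] at h0
    rw [h0, zero_smul]
  · simp

/-- The eigenvalues of a diagonal map that is irreducible tridiagonal in some other basis are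
distinct. -/
theorem diag_injective {b b' : Basis (Fin (d + 1)) K V} {A : End K V}
    (h : (LinearMap.toMatrix b b A).IsDiag)
    (h' : IsIrreducibleTridiagonal (LinearMap.toMatrix b' b' A)) :
    Function.Injective fun j => LinearMap.toMatrix b b A j j := by
  intro i j hij
  simp only at hij
  by_contra hne
  obtain ⟨c, hc⟩ := exists_smul_eq_of_eigenvector h' (apply_basis_of_isDiag h i)
    (hij ▸ apply_basis_of_isDiag h j) (b.ne_zero i)
  have := congrArg (fun v => b.repr v j) hc
  simp [hne] at this

theorem aeval_apply_mem {A : End K V} {U : Submodule K V} (hU : ∀ u ∈ U, A u ∈ U)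
    (p : Polynomial K) {u : V} (hu : u ∈ U) : Polynomial.aeval A p u ∈ U := by
  induction p using Polynomial.induction_on' with
  | add p q hp hq => rw [map_add]; exact U.add_mem hp hq
  | monomial n a =>
    rw [Polynomial.aeval_monomial]
    refine U.smul_mem a ?_
    induction n with
    | zero => simpa using hu
    | succ n ih => rw [pow_succ']; exact hU _ ih

/-- The Lagrange polynomial of the node `θ i`, evaluated at `A`, is the projection onto the line of
`b i`, and polynomials in `A` preserve `U`. -/
theorem repr_smul_mem {b : Basis (Fin (d + 1)) K V} {A : End K V} {θ : Fin (d + 1) → K}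
    (hA : ∀ j, A (b j) = θ j • b j) (hθ : Function.Injective θ) {U : Submodule K V}
    (hU : ∀ u ∈ U, A u ∈ U) {u : V} (hu : u ∈ U) (i : Fin (d + 1)) :
    b.repr u i • b i ∈ U := by
  have h := aeval_apply_mem hU (Lagrange.basis Finset.univ θ i) hu
  rw [← b.sum_repr u, map_sum, Finset.sum_eq_single i] at h
  · rwa [map_smul, Module.End.aeval_apply_of_mem_apply_eq_smul (hA i),
      Lagrange.eval_basis_self hθ.injOn (Finset.mem_univ i), one_smul] at h
  · intro j _ hj
    rw [map_smul, Module.End.aeval_apply_of_mem_apply_eq_smul (hA j),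
      Lagrange.eval_basis_of_ne hj.symm (Finset.mem_univ j), zero_smul, smul_zero]
  · simp

/-- An irreducible tridiagonal map and a diagonal map with distinct eigenvalues have no common
proper nonzero invariant subspace. -/
theorem eq_top_of_invariant {b : Basis (Fin (d + 1)) K V} {A As : End K V} {θ : Fin (d + 1) → K}
    (hA : IsIrreducibleTridiagonal (LinearMap.toMatrix b b A))
    (hAs : ∀ j, As (b j) = θ j • b j) (hθ : Function.Injective θ) {U : Submodule K V}
    (hUA : ∀ u ∈ U, A u ∈ U) (hUAs : ∀ u ∈ U, As u ∈ U) (hU : U ≠ ⊥) : U = ⊤ := by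
  have mem_of_ne : ∀ u ∈ U, ∀ i, b.repr u i ≠ 0 → b i ∈ U := fun u hu i hi =>
    (U.smul_mem_iff hi).mp (repr_smul_mem hAs hθ hUAs hu i)
  have step : ∀ i k : Fin (d + 1), b i ∈ U → LinearMap.toMatrix b b A k i ≠ 0 → b k ∈ U := by
    intro i k hi hk
    rw [LinearMap.toMatrix_apply] at hk
    exact mem_of_ne _ (hUA _ hi) k hk
  obtain ⟨u, hu, hu0⟩ := U.ne_bot_iff.mp hU
  obtain ⟨i, hi⟩ : ∃ i, b.repr u i ≠ 0 := by
    by_contra! h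
    exact hu0 (b.repr.map_eq_zero_iff.mp (Finsupp.ext h))
  have hbi := mem_of_ne u hu i hi
  have up : ∀ n : ℕ, ∀ k : Fin (d + 1), (k : ℕ) = i + n → b k ∈ U := by
    intro n
    induction n with
    | zero => intro k hk; rwa [show k = i from Fin.ext hk]
    | succ n ih =>
      intro k hk
      let k' : Fin (d + 1) := ⟨i + n, by omega⟩
      exact step k' k (ih k' rfl) (hA.2 k' k (by simp only [k']; omega)).2
  have down : ∀ n : ℕ, ∀ k : Fin (d + 1), (k : ℕ) + n = i → b k ∈ U := by
    intro n
    induction n with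
    | zero => intro k hk; rwa [show k = i from Fin.ext hk]
    | succ n ih =>
      intro k hk
      let k' : Fin (d + 1) := ⟨k + 1, by omega⟩
      exact step k' k (ih k' (by simp only [k']; omega)) (hA.2 k k' rfl).1
  rw [eq_top_iff, ← b.span_eq, Submodule.span_le]
  rintro _ ⟨k, rfl⟩
  rcases le_total (i : ℕ) k with h | h
  · exact up (k - i) k (by omega)
  · exact down (i - k) k (by omega)

/-- The sequence of `A`-eigenvectors obtained from `v` by repeatedly applying `As` and removing
the component in the previous eigenspace. -/
def eigenString (A As : End K V) (θ : ℕ → K) (v : V) : ℕ → V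
  | 0 => v
  | 1 => As v
  | n + 2 => (θ (n + 2) - θ n)⁻¹ • (A (As (eigenString A As θ v (n + 1))) -
      θ n • As (eigenString A As θ v (n + 1)))

/-- On an eigenvector `w` the relation becomes the polynomial X² - β y X + (y² - ρ) in `A` acting on
`As w`; the hypotheses say that its roots are `x` and `z`. -/
theorem apply_apply_of_relation {A As : End K V} {β ρ x y z : K} {w : V}
    (hAW : A ^ 2 * As - β • (A * As * A) + As * A ^ 2 - ρ • As = 0)
    (hadd : x + z = β * y) (hmul : x * z = y ^ 2 - ρ) (hw : A w = y • w) :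
    A (A (As w)) = (x + z) • A (As w) - (x * z) • As w := by
  have h := congrArg (fun f : End K V => f w) hAW
  simp only [LinearMap.sub_apply, LinearMap.add_apply, LinearMap.smul_apply, pow_two,
    Module.End.mul_apply, hw, map_smul, LinearMap.zero_apply] at h
  rw [hadd, hmul, ← sub_eq_zero, ← h]
  module

/-- `A - θ n` carries the kernel of `(A - θ n)(A - θ (n + 2))` into the eigenspace of `θ (n + 2)`.
-/
theorem apply_eigenString {A As : End K V} {β ρ : K} {θ : ℕ → K} {v : V}
    (hAW : A ^ 2 * As - β • (A * As * A) + As * A ^ 2 - ρ • As = 0)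
    (hadd : ∀ n, θ n + θ (n + 2) = β * θ (n + 1))
    (hmul : ∀ n, θ n * θ (n + 2) = θ (n + 1) ^ 2 - ρ)
    (h0 : A v = θ 0 • v) (h1 : A (As v) = θ 1 • As v) (n : ℕ) :
    A (eigenString A As θ v n) = θ n • eigenString A As θ v n := by
  induction n using Nat.twoStepInduction with
  | zero => exact h0
  | one => exact h1
  | more n _ ih =>
    rw [eigenString]
    set w := eigenString A As θ v (n + 1)
    have e := apply_apply_of_relation hAW (hadd n) (hmul n) ih
    rw [map_smul, map_sub, map_smul, e]
    module

/-- Since `θ n ≠ θ (n + 2)`, the vector `As w` is the sum of its components in these two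
eigenspaces. The scalar in `eigenString` makes the next string vector exactly the component for `θ
(n + 2)`. -/
theorem exists_apply_eigenString {A As : End K V} {β ρ : K} {θ : ℕ → K} {v : V}
    (hAW : A ^ 2 * As - β • (A * As * A) + As * A ^ 2 - ρ • As = 0)
    (hadd : ∀ n, θ n + θ (n + 2) = β * θ (n + 1))
    (hmul : ∀ n, θ n * θ (n + 2) = θ (n + 1) ^ 2 - ρ) (hne : ∀ n, θ n ≠ θ (n + 2))
    (h0 : A v = θ 0 • v) (h1 : A (As v) = θ 1 • As v) (n : ℕ) :
    ∃ w, A w = θ n • w ∧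
      As (eigenString A As θ v (n + 1)) = eigenString A As θ v (n + 2) + w := by
  have hn := sub_ne_zero.mpr (hne n).symm
  have ih := apply_eigenString hAW hadd hmul h0 h1 (n + 1)
  rw [eigenString]
  set w := eigenString A As θ v (n + 1)
  have e := apply_apply_of_relation hAW (hadd n) (hmul n) ih
  refine ⟨(θ (n + 2) - θ n)⁻¹ • (θ (n + 2) • As w - A (As w)), ?_, ?_⟩
  · rw [map_smul, map_sub, map_smul, e]
    module
  · rw [← smul_add, eq_inv_smul_iff₀ hn]
    module

/-- Suppose `A` is irreducible tridiagonal in a basis in which `As` is diagonal with distinct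
eigenvalues, and the first Askey-Wilson relation holds. If the eigenvalues `θ` of `A` form a string
starting at the extremal eigenvector `v`, then `(A, As)` is a Leonard pair. -/
theorem isLeonardPair_of_eigenString {b : Basis (Fin (d + 1)) K V} {A As : End K V}
    {θs : Fin (d + 1) → K} {β ρ : K} {θ : ℕ → K} {v : V}
    (hA : IsIrreducibleTridiagonal (LinearMap.toMatrix b b A))
    (hAs : ∀ j, As (b j) = θs j • b j) (hθs : Function.Injective θs)
    (hAW : A ^ 2 * As - β • (A * As * A) + As * A ^ 2 - ρ • As = 0)
    (hadd : ∀ n, θ n + θ (n + 2) = β * θ (n + 1))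
    (hmul : ∀ n, θ n * θ (n + 2) = θ (n + 1) ^ 2 - ρ) (hne : ∀ n, θ n ≠ θ (n + 2))
    (hinj : ∀ i j, i < j → j ≤ d + 1 → i < d → θ i ≠ θ j)
    (hv : v ≠ 0) (h0 : A v = θ 0 • v) (h1 : A (As v) = θ 1 • As v) : IsLeonardPair A As := by
  have hfin : Module.Finite K V := Module.Finite.of_basis b
  have hrank : finrank K V = d + 1 := by rw [finrank_eq_card_basis b, Fintype.card_fin]
  set w := eigenString A As θ v with hw
  have hAw : ∀ n, A (w n) = θ n • w n := apply_eigenString hAW hadd hmul h0 h1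
  have hAsw0 : As (w 0) = w 1 := rfl
  have hAsw : ∀ n, w n ≠ 0 → ∃ c : K, As (w (n + 1)) = w (n + 2) + c • w n := by
    intro n hn
    obtain ⟨u, hu, hu'⟩ := exists_apply_eigenString hAW hadd hmul hne h0 h1 n
    obtain ⟨c, rfl⟩ := exists_smul_eq_of_eigenvector hA (hAw n) hu hn
    exact ⟨c, hu'⟩
  -- If `w m` were the first zero vector, `w 0, …, w (m - 1)` would span an invariant subspace of
  -- dimension at most m ≤ d.
  have hw0 : ∀ n, n ≤ d → w n ≠ 0 := by
    intro n
    induction n using Nat.strong_induction_on with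
    | _ m ih =>
      intro hm hzero
      have hm0 : m ≠ 0 := by rintro rfl; exact hv hzero
      have key : Submodule.span K (w '' Set.Iio m) = ⊤ := by
        refine eq_top_of_invariant hA hAs hθs ?_ ?_ ?_
        · intro u hu
          refine (Submodule.span_le (p := (Submodule.span K (w '' Set.Iio m)).comap A)).mpr ?_ hu
          rintro _ ⟨j, hj, rfl⟩
          rw [SetLike.mem_coe, Submodule.mem_comap, hAw]
          exact Submodule.smul_mem _ _ (Submodule.subset_span ⟨j, hj, rfl⟩)
        · intro u hu
          refine (Submodule.span_le (p := (Submodule.span K (w '' Set.Iio m)).comap As)).mpr ?_ hu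
          rintro _ ⟨j, hj, rfl⟩
          rw [SetLike.mem_coe, Submodule.mem_comap]
          have hj' : j < m := hj
          have next : w (j + 1) ∈ Submodule.span K (w '' Set.Iio m) := by
            rcases Nat.lt_or_ge (j + 1) m with h | h
            · exact Submodule.subset_span ⟨j + 1, h, rfl⟩
            · rw [show j + 1 = m by omega, hzero]
              exact Submodule.zero_mem _
          cases j with
          | zero => rw [hAsw0]; exact next
          | succ j =>
            obtain ⟨c, hc⟩ := hAsw j (ih j (by omega) (by omega))
            rw [hc]
            exact Submodule.add_mem _ next
              (Submodule.smul_mem _ _ (Submodule.subset_span ⟨j, by simp; omega, rfl⟩))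
        · rw [Submodule.ne_bot_iff]
          exact ⟨w 0, Submodule.subset_span ⟨0, Nat.pos_of_ne_zero hm0, rfl⟩, hv⟩
      classical
      have hle := finrank_span_finset_le_card (R := K) ((Finset.range m).image w)
      have hcard := Finset.card_image_le (s := Finset.range m) (f := w)
      rw [Set.finrank, Finset.coe_image, Finset.coe_range, key, finrank_top, hrank] at hle
      rw [Finset.card_range] at hcard
      omega
  have hinj' : Function.Injective fun i : Fin (d + 1) => θ i := by
    intro i j hij
    by_contra hne
    rcases lt_or_gt_of_ne (fun h => hne (Fin.ext h) : (i : ℕ) ≠ j) with h | h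
    · exact hinj i j h (by omega) (by omega) hij
    · exact hinj j i h (by omega) (by omega) hij.symm
  have hli : LinearIndependent K fun i : Fin (d + 1) => w i :=
    Module.End.eigenvectors_linearIndependent' A _ hinj' _ fun i =>
      ⟨Module.End.mem_eigenspace_iff.mpr (hAw i), hw0 i (by omega)⟩
  let c := basisOfLinearIndependentOfCardEqFinrank hli (by rw [hrank, Fintype.card_fin])
  have hc : ∀ i, c i = w i := fun i => by simp [c]
  have hAc : ∀ i, A (c i) = θ i • c i := fun i => by rw [hc, hAw]
  -- `w (d + 1)` need not vanish: `hinj` allows `θ (d + 1) = θ d`, and then it can be a multiple of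
  -- the last basis vector, giving `As` a diagonal entry in the corner. This happens for the second
  -- model.
  have hlast : ∀ i : Fin (d + 1), (i : ℕ) < d → c.repr (w (d + 1)) i = 0 := by
    intro i hi
    have h := hAw (d + 1)
    have h2 : c.repr (A (w (d + 1))) i = θ i * c.repr (w (d + 1)) i := by
      conv_lhs => rw [← c.sum_repr (w (d + 1))]
      simp only [map_sum, map_smul, hAc]
      simp [Finsupp.single_apply, mul_comm]
    rw [h, map_smul, Finsupp.smul_apply, smul_eq_mul, ← sub_eq_zero, ← sub_mul] at h2
    exact (mul_eq_zero.mp h2).resolve_left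
      (sub_ne_zero.mpr (hinj i (d + 1) (by omega) le_rfl hi).symm)
  have hreprw : ∀ n ≤ d, ∀ i : Fin (d + 1), c.repr (w n) i = if n = (i : ℕ) then 1 else 0 := by
    intro n hn i
    have := hc ⟨n, by omega⟩
    simp only at this
    rw [← this, c.repr_self, Finsupp.single_apply]
    simp [Fin.ext_iff]
  have hreprw' : ∀ n ≤ d + 1, ∀ i : Fin (d + 1), (i : ℕ) ≠ n → (i : ℕ) < d → c.repr (w n) i = 0 := by
    intro n hn i hi hid
    rcases Nat.lt_or_ge n (d + 1) with h | h
    · rw [hreprw n (by omega), if_neg (Ne.symm hi)]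
    · rw [show n = d + 1 by omega, hlast i hid]
  choose! k hk using hAsw
  refine ⟨⟨d, b, hA, ?_⟩, ⟨d, c, ?_, ?_, ?_⟩⟩
  · intro i j hij
    rw [LinearMap.toMatrix_apply, hAs]
    simp [hij.symm]
  · intro i j hij
    rw [LinearMap.toMatrix_apply, hAc]
    simp [hij.symm]
  · rintro i ⟨j, hj⟩ hij
    simp only at hij
    rw [LinearMap.toMatrix_apply, hc]
    cases j with
    | zero =>
      rw [hAsw0]
      exact (hreprw 1 (by omega) i).trans (if_neg (by omega))
    | succ j =>
      simp only
      rw [hk j (hw0 j (by omega)), map_add, map_smul, Finsupp.add_apply, Finsupp.smul_apply,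
        hreprw j (by omega), if_neg (by omega), smul_zero, add_zero]
      rcases hij with h | h
      · exact hreprw' _ (by omega) i (by omega) (by omega)
      · rw [hreprw _ (by omega), if_neg (by omega)]
  · rintro ⟨i, hi⟩ ⟨j, hj⟩ hij
    simp only at hij
    subst hij
    have hsup : LinearMap.toMatrix c c As ⟨i, hi⟩ ⟨i + 1, hj⟩ = k i := by
      rw [LinearMap.toMatrix_apply, hc]
      simp only
      rw [hk i (hw0 i (by omega)), map_add, map_smul, Finsupp.add_apply, Finsupp.smul_apply,
        hreprw i (by omega), if_pos rfl, hreprw' _ (by omega) _ (by simp) (by simp; omega)]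
      simp
    constructor
    · rw [hsup]
      intro hki
      -- If the superdiagonal entry `k i` vanished, the basis vectors beyond `i` would span an
      -- invariant subspace.
      have key : Submodule.span K (c '' Set.Ici ⟨i + 1, hj⟩) = ⊤ := by
        refine eq_top_of_invariant hA hAs hθs ?_ ?_ ?_
        · intro u hu
          refine (Submodule.span_le
            (p := (Submodule.span K (c '' Set.Ici ⟨i + 1, hj⟩)).comap A)).mpr ?_ hu
          rintro _ ⟨j, hj, rfl⟩
          rw [SetLike.mem_coe, Submodule.mem_comap, hAc]
          exact Submodule.smul_mem _ _ (Submodule.subset_span ⟨j, hj, rfl⟩)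
        · intro u hu
          refine (Submodule.span_le
            (p := (Submodule.span K (c '' Set.Ici ⟨i + 1, hj⟩)).comap As)).mpr ?_ hu
          rintro _ ⟨⟨l, hl⟩, hl', rfl⟩
          rw [SetLike.mem_coe, Submodule.mem_comap, hc]
          obtain ⟨l, rfl⟩ : ∃ l', l = l' + 1 := ⟨l - 1, by
            simp only [Set.mem_Ici, Fin.mk_le_mk] at hl'; omega⟩
          simp only [Set.mem_Ici, Fin.mk_le_mk] at hl'
          simp only
          rw [hk l (hw0 l (by omega)), ← c.sum_repr (w (l + 2))]
          refine Submodule.add_mem _ (Submodule.sum_mem _ fun m _ => ?_) ?_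
          · by_cases hm : i + 1 ≤ (m : ℕ)
            · exact Submodule.smul_mem _ _ (Submodule.subset_span ⟨m, hm, rfl⟩)
            · rw [hreprw' _ (by omega) m (by omega) (by omega), zero_smul]
              exact Submodule.zero_mem _
          · rcases Nat.eq_or_lt_of_le hl' with h | h
            · rw [← show i = l by omega, hki, zero_smul]
              exact Submodule.zero_mem _
            · exact Submodule.smul_mem _ _ (Submodule.subset_span
                ⟨⟨l, by omega⟩, by simp only [Set.mem_Ici, Fin.mk_le_mk]; omega, hc _⟩)
        · rw [Submodule.ne_bot_iff]
          exact ⟨c ⟨i + 1, hj⟩, Submodule.subset_span ⟨_, Set.self_mem_Ici, rfl⟩, c.ne_zero _⟩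
      have hmem : c ⟨i, hi⟩ ∈ Submodule.span K (c '' Set.Ici ⟨i + 1, hj⟩) := key ▸ trivial
      rw [c.mem_span_image, c.repr_self] at hmem
      have := hmem (by simp : (⟨i, hi⟩ : Fin (d + 1)) ∈ _)
      simp at this
    · rw [LinearMap.toMatrix_apply, hc]
      simp only
      cases i with
      | zero => rw [hAsw0, hreprw 1 (by omega)]; simp
      | succ i =>
        rw [hk i (hw0 i (by omega)), map_add, map_smul, Finsupp.add_apply, Finsupp.smul_apply,
          hreprw i (by omega), if_neg (by simp; omega), hreprw _ (by omega)]
        simp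

end LinearAlgebra

/-! ### Integer-indexed entries and the relations on a basis -/

section Entries

open Module

variable {K V : Type*} [Field K] [AddCommGroup V] [Module K V] {d n : ℕ}

/-- Extension by zero of a finite family to all integer indices. -/
def zext {M : Type*} [AddCommMonoid M] (g : Fin n → M) (z : ℤ) : M :=
  ∑ k : Fin n, if ((k : ℕ) : ℤ) = z then g k else 0

theorem zext_coe {M : Type*} [AddCommMonoid M] (g : Fin n → M) (k : Fin n) :
    zext g (k : ℕ) = g k := by
  rw [zext, Finset.sum_eq_single k]
  · simp
  · intro j _ hj
    rw [if_neg]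
    exact fun h => hj (Fin.ext (by exact_mod_cast h))
  · simp

theorem zext_of_neg {M : Type*} [AddCommMonoid M] (g : Fin n → M) {z : ℤ} (h : z < 0) :
    zext g z = 0 :=
  Finset.sum_eq_zero fun k _ => if_neg (by omega)

theorem zext_of_ge {M : Type*} [AddCommMonoid M] (g : Fin n → M) {z : ℤ} (h : (n : ℤ) ≤ z) :
    zext g z = 0 :=
  Finset.sum_eq_zero fun k _ => if_neg (by omega)

theorem exists_fin_eq {z : ℤ} (h0 : 0 ≤ z) (h : z < n) : ∃ k : Fin n, z = (k : ℕ) :=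
  ⟨⟨z.toNat, by omega⟩, by simp [h0]⟩

theorem sum_eq_zext_add_zext_add_zext {M : Type*} [AddCommMonoid M] (g : Fin n → M) (i : ℤ)
    (h : ∀ k : Fin n, ((k : ℕ) : ℤ) + 1 < i ∨ i + 1 < (k : ℕ) → g k = 0) :
    ∑ k, g k = zext g (i + 1) + zext g i + zext g (i - 1) := by
  simp only [zext, ← Finset.sum_add_distrib]
  refine Finset.sum_congr rfl fun k _ => ?_
  by_cases h1 : ((k : ℕ) : ℤ) = i + 1
  · rw [if_pos h1, if_neg (by omega), if_neg (by omega), add_zero, add_zero]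
  by_cases h2 : ((k : ℕ) : ℤ) = i
  · rw [if_neg h1, if_pos h2, if_neg (by omega), zero_add, add_zero]
  by_cases h3 : ((k : ℕ) : ℤ) = i - 1
  · rw [if_neg h1, if_neg h2, if_pos h3, zero_add, zero_add]
  · rw [if_neg h1, if_neg h2, if_neg h3, h k (by omega)]
    simp

/-- The entries of a square matrix, extended by zero to all integer indices. -/
def entry (M : Matrix (Fin n) (Fin n) K) (i j : ℤ) : K :=
  zext (fun k => zext (M k) j) i

theorem entry_coe (M : Matrix (Fin n) (Fin n) K) (i j : Fin n) :
    entry M (i : ℕ) (j : ℕ) = M i j := by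
  rw [entry, zext_coe, zext_coe]

theorem entry_of_row_neg (M : Matrix (Fin n) (Fin n) K) {i : ℤ} (j : ℤ) (h : i < 0) :
    entry M i j = 0 :=
  zext_of_neg _ h

theorem entry_of_row_ge (M : Matrix (Fin n) (Fin n) K) {i : ℤ} (j : ℤ) (h : (n : ℤ) ≤ i) :
    entry M i j = 0 :=
  zext_of_ge _ h

theorem entry_of_col_neg (M : Matrix (Fin n) (Fin n) K) (i : ℤ) {j : ℤ} (h : j < 0) :
    entry M i j = 0 := by
  rw [entry, zext]
  exact Finset.sum_eq_zero fun k _ => by rw [zext_of_neg _ h, ite_self]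

theorem entry_of_col_ge (M : Matrix (Fin n) (Fin n) K) (i : ℤ) {j : ℤ} (h : (n : ℤ) ≤ j) :
    entry M i j = 0 := by
  rw [entry, zext]
  exact Finset.sum_eq_zero fun k _ => by rw [zext_of_ge _ h, ite_self]

/-- Out of range both sides vanish, so the ends of the basis need no separate formula. -/
theorem apply_zext {b : Basis (Fin n) K V} {A : End K V}
    (hA : ∀ i j : Fin n, (i : ℕ) + 1 < j ∨ (j : ℕ) + 1 < i → LinearMap.toMatrix b b A i j = 0)
    (j : ℤ) :
    A (zext b j) = entry (LinearMap.toMatrix b b A) (j + 1) j • zext b (j + 1) +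
      entry (LinearMap.toMatrix b b A) j j • zext b j +
      entry (LinearMap.toMatrix b b A) (j - 1) j • zext b (j - 1) := by
  rcases lt_or_ge j 0 with h | h
  · simp [zext_of_neg _ h, entry_of_col_neg _ _ h]
  rcases lt_or_ge j n with h' | h'
  swap
  · simp [zext_of_ge _ h', entry_of_col_ge _ _ h']
  obtain ⟨k, rfl⟩ := exists_fin_eq h h'
  rw [zext_coe, ← b.sum_repr (A (b k)),
    sum_eq_zext_add_zext_add_zext _ ((k : ℕ) : ℤ)]
  · have key : ∀ z : ℤ, zext (fun i => b.repr (A (b k)) i • b i) z =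
        entry (LinearMap.toMatrix b b A) z (k : ℕ) • zext b z := by
      intro z
      rcases lt_or_ge z 0 with h | h
      · simp [zext_of_neg _ h]
      rcases lt_or_ge z n with h' | h'
      · obtain ⟨i, rfl⟩ := exists_fin_eq h h'
        rw [zext_coe, zext_coe, entry_coe, LinearMap.toMatrix_apply]
      · simp [zext_of_ge _ h']
    rw [key, key, key, zext_coe]
  · intro i hi
    rw [← LinearMap.toMatrix_apply b b A i k, hA i k (by omega), zero_smul]

/-- The values of `w` outside the range are arbitrary, because the matrix entries multiplying them
are zero. Strings defined on all integers can therefore be inserted directly. -/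
theorem mulVec_eq {N : Matrix (Fin n) (Fin n) K}
    (hN : ∀ i j : Fin n, (i : ℕ) + 1 < j ∨ (j : ℕ) + 1 < i → N i j = 0) (w : ℤ → K) (i : Fin n) :
    N.mulVec (fun k => w (k : ℕ)) i = entry N (i : ℕ) ((i : ℕ) + 1) * w ((i : ℕ) + 1) +
      entry N (i : ℕ) (i : ℕ) * w (i : ℕ) + entry N (i : ℕ) ((i : ℕ) - 1) * w ((i : ℕ) - 1) := by
  have key : ∀ z : ℤ, zext (fun k : Fin n => N i k * w (k : ℕ)) z = entry N (i : ℕ) z * w z := by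
    intro z
    rcases lt_or_ge z 0 with h | h
    · rw [zext_of_neg _ h, entry_of_col_neg _ _ h, zero_mul]
    rcases lt_or_ge z n with h' | h'
    · obtain ⟨k, rfl⟩ := exists_fin_eq h h'
      rw [zext_coe, entry_coe]
    · rw [zext_of_ge _ h', entry_of_col_ge _ _ h', zero_mul]
  rw [Matrix.mulVec, dotProduct, sum_eq_zext_add_zext_add_zext _ ((i : ℕ) : ℤ), key, key, key]
  intro k hk
  rw [hN i k (by omega), zero_mul]

theorem coord_zext (b : Basis (Fin n) K V) (i : Fin n) (z : ℤ) :
    b.coord i (zext b z) = if z = (i : ℕ) then 1 else 0 := by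
  rcases lt_or_ge z 0 with h | h
  · rw [zext_of_neg _ h, map_zero, if_neg (by omega)]
  rcases lt_or_ge z n with h' | h'
  · obtain ⟨k, rfl⟩ := exists_fin_eq h h'
    rw [zext_coe, b.coord_apply, b.repr_self, Finsupp.single_apply]
    simp [Fin.ext_iff]
  · rw [zext_of_ge _ h', map_zero, if_neg (by omega)]

section Relations

open Module

variable {A As : End K V} {e : ℤ → V} {p a m θ : ℤ → K}

/-- The coefficients at distance two carry the linear recurrence for the eigenvalues of `As`; the
coefficient of `e j` is the equation for the products of opposite off-diagonal entries. -/
theorem aw_left_apply (hA : ∀ j, A (e j) = p j • e (j + 1) + a j • e j + m j • e (j - 1))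
    (hAs : ∀ j, As (e j) = θ j • e j) (β ρ : K) (j : ℤ) :
    (A ^ 2 * As - β • (A * As * A) + As * A ^ 2 - ρ • As) (e j) =
      (p j * p (j + 1) * (θ j + θ (j + 2) - β * θ (j + 1))) • e (j + 2) +
      (p j * ((a j + a (j + 1)) * (θ j + θ (j + 1)) -
        β * (a j * θ j + a (j + 1) * θ (j + 1)))) • e (j + 1) +
      (2 * θ j * (m j * p (j - 1) + m (j + 1) * p j + a j ^ 2) -
        β * (m j * p (j - 1) * θ (j - 1) + m (j + 1) * p j * θ (j + 1) + a j ^ 2 * θ j) -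
        ρ * θ j) • e j +
      (m j * ((a j + a (j - 1)) * (θ j + θ (j - 1)) -
        β * (a j * θ j + a (j - 1) * θ (j - 1)))) • e (j - 1) +
      (m j * m (j - 1) * (θ j + θ (j - 2) - β * θ (j - 1))) • e (j - 2) := by
  simp only [LinearMap.sub_apply, LinearMap.add_apply, LinearMap.smul_apply, pow_two,
    Module.End.mul_apply, hA, hAs, map_smul, map_add, sub_add_cancel, add_sub_cancel_right]
  rw [show j + 1 + 1 = j + 2 by ring, show j - 1 - 1 = j - 2 by ring]
  module

/-- The off-diagonal coefficients carry the quadratic relation between consecutive eigenvalues; the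
coefficient of `e j` restricts where the diagonal of `A` can be nonzero. -/
theorem aw_right_apply (hA : ∀ j, A (e j) = p j • e (j + 1) + a j • e j + m j • e (j - 1))
    (hAs : ∀ j, As (e j) = θ j • e j) (β ρ : K) (j : ℤ) :
    (As ^ 2 * A - β • (As * A * As) + A * As ^ 2 - ρ • A) (e j) =
      (p j * (θ j ^ 2 - β * θ j * θ (j + 1) + θ (j + 1) ^ 2 - ρ)) • e (j + 1) +
      (a j * ((2 - β) * θ j ^ 2 - ρ)) • e j +
      (m j * (θ j ^ 2 - β * θ j * θ (j - 1) + θ (j - 1) ^ 2 - ρ)) • e (j - 1) := by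
  simp only [LinearMap.sub_apply, LinearMap.add_apply, LinearMap.smul_apply, pow_two,
    Module.End.mul_apply, hA, hAs, map_smul, map_add]
  module

end Relations

theorem satisfiesAW_iff {β ρ : K} {A As : End K V} :
    SatisfiesAW β 0 0 ρ ρ 0 0 0 A As ↔
      A ^ 2 * As - β • (A * As * A) + As * A ^ 2 - ρ • As = 0 ∧
      As ^ 2 * A - β • (As * A * As) + A * As ^ 2 - ρ • A = 0 := by
  simp [SatisfiesAW]

end Entries

/-! ### Identities for strings, and powers of q -/

section Strings

open Module

variable {K : Type*} [Field K]

/-- `u q^{2j} + u⁻¹ q^{-2j}` -/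
def stringSum (u q : K) (j : ℤ) : K := u * q ^ (2 * j) + (u * q ^ (2 * j))⁻¹

/-- `u q^{2j} - u⁻¹ q^{-2j}` -/
def stringDiff (u q : K) (j : ℤ) : K := u * q ^ (2 * j) - (u * q ^ (2 * j))⁻¹

/-- `u² q^{4j-2} + u⁻² q^{2-4j}` -/
def stringGap (u q : K) (j : ℤ) : K :=
  (u * q ^ (2 * j)) ^ 2 * (q ^ 2)⁻¹ + ((u * q ^ (2 * j)) ^ 2)⁻¹ * q ^ 2

variable {u q : K}

theorem mul_zpow_two_mul_add_one (hq : q ≠ 0) (j : ℤ) :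
    u * q ^ (2 * (j + 1)) = u * q ^ (2 * j) * q ^ 2 := by
  rw [mul_add, zpow_add₀ hq, mul_assoc]
  norm_cast

theorem mul_zpow_two_mul_add_two (hq : q ≠ 0) (j : ℤ) :
    u * q ^ (2 * (j + 2)) = u * q ^ (2 * j) * q ^ 4 := by
  rw [mul_add, zpow_add₀ hq, mul_assoc]
  norm_cast

theorem mul_zpow_two_mul_sub_one (hq : q ≠ 0) (j : ℤ) :
    u * q ^ (2 * (j - 1)) = u * q ^ (2 * j) * (q ^ 2)⁻¹ := by
  rw [mul_sub, zpow_sub₀ hq, mul_div_assoc', div_eq_mul_inv]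
  norm_cast

theorem stringSum_add_two (hu : u ≠ 0) (hq : q ≠ 0) (j : ℤ) :
    stringSum u q j + stringSum u q (j + 2) = (q ^ 2 + (q ^ 2)⁻¹) * stringSum u q (j + 1) := by
  have ht : u * q ^ (2 * j) ≠ 0 := mul_ne_zero hu (zpow_ne_zero _ hq)
  simp only [stringSum, mul_zpow_two_mul_add_one hq, mul_zpow_two_mul_add_two hq]
  generalize u * q ^ (2 * j) = t at *
  field_simp
  ring

theorem stringSum_mul_add_two (hu : u ≠ 0) (hq : q ≠ 0) (j : ℤ) :
    stringSum u q j * stringSum u q (j + 2) =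
      stringSum u q (j + 1) ^ 2 - (4 - (q ^ 2 + (q ^ 2)⁻¹) ^ 2) := by
  have ht : u * q ^ (2 * j) ≠ 0 := mul_ne_zero hu (zpow_ne_zero _ hq)
  simp only [stringSum, mul_zpow_two_mul_add_one hq, mul_zpow_two_mul_add_two hq]
  generalize u * q ^ (2 * j) = t at *
  field_simp
  ring

/-- For u q^{2j} + v q^{-2j} the left side would be u v (4 - β²), whatever j; a string has u v = 1.
-/
theorem stringSum_sq (hu : u ≠ 0) (hq : q ≠ 0) (j : ℤ) :
    stringSum u q j ^ 2 - (q ^ 2 + (q ^ 2)⁻¹) * stringSum u q j * stringSum u q (j + 1) +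
      stringSum u q (j + 1) ^ 2 = 4 - (q ^ 2 + (q ^ 2)⁻¹) ^ 2 := by
  have ht : u * q ^ (2 * j) ≠ 0 := mul_ne_zero hu (zpow_ne_zero _ hq)
  simp only [stringSum, mul_zpow_two_mul_add_one hq]
  generalize u * q ^ (2 * j) = t at *
  field_simp
  ring

/-- The diagonal part of the first Askey-Wilson relation, multiplied by `stringDiff u q j`,
telescopes. -/
theorem stringDiff_mul_diagonal (hu : u ≠ 0) (hq : q ≠ 0) (x y a : K) (j : ℤ) :
    stringDiff u q j * (2 * stringSum u q j * (x + y + a ^ 2) -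
        (q ^ 2 + (q ^ 2)⁻¹) * (x * stringSum u q (j - 1) + y * stringSum u q (j + 1) +
          a ^ 2 * stringSum u q j) - (4 - (q ^ 2 + (q ^ 2)⁻¹) ^ 2) * stringSum u q j) =
      (q ^ 2 - (q ^ 2)⁻¹) * (x * (stringDiff u q j * stringDiff u q (j - 1)) -
        y * (stringDiff u q (j + 1) * stringDiff u q j) +
        (stringGap u q (j + 1) - stringGap u q j)) +
      (2 - (q ^ 2 + (q ^ 2)⁻¹)) * a ^ 2 * (stringSum u q j * stringDiff u q j) := by
  have ht : u * q ^ (2 * j) ≠ 0 := mul_ne_zero hu (zpow_ne_zero _ hq)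
  simp only [stringSum, stringDiff, stringGap, mul_zpow_two_mul_add_one hq,
    mul_zpow_two_mul_sub_one hq]
  generalize u * q ^ (2 * j) = t at *
  field_simp
  ring

theorem add_inv_eq_add_inv {a b : K} (ha : a ≠ 0) (hb : b ≠ 0) (h : a + a⁻¹ = b + b⁻¹) :
    a = b ∨ a * b = 1 := by
  have : (a - b) * (a * b - 1) = 0 := by
    field_simp at h
    linear_combination h
  rcases mul_eq_zero.mp this with h | h
  · exact Or.inl (sub_eq_zero.mp h)
  · exact Or.inr (sub_eq_zero.mp h)

theorem sub_inv_ne_zero {a : K} (ha : a ≠ 0) (h : a ^ 2 ≠ 1) : a - a⁻¹ ≠ 0 := by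
  intro h'
  apply h
  field_simp at h'
  linear_combination h'

theorem zpow_ne_one_of_pow_ne_one (hq : ∀ n : ℕ, 0 < n → q ^ n ≠ 1) {n : ℤ} (hn : n ≠ 0) :
    q ^ n ≠ 1 := by
  intro h
  obtain ⟨k, rfl | rfl⟩ := n.eq_nat_or_neg
  · exact hq k (by omega) (by exact_mod_cast h)
  · rw [zpow_neg, inv_eq_one] at h
    exact hq k (by omega) (by exact_mod_cast h)

/-- Squaring gives q^{2n} = 1, hence n = 0, and 1 = -1 is excluded by the characteristic. -/
theorem zpow_ne_neg_one (h2 : (2 : K) ≠ 0) (hq : ∀ n : ℕ, 0 < n → q ^ n ≠ 1) (n : ℤ) :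
    q ^ n ≠ -1 := by
  intro h
  rcases eq_or_ne n 0 with rfl | hn
  · rw [zpow_zero] at h
    exact h2 (by linear_combination h)
  · refine zpow_ne_one_of_pow_ne_one hq (n := n * 2) (by omega) ?_
    rw [zpow_mul, h]
    norm_num

theorem zpow_inj_of_pow_ne_one (hq0 : q ≠ 0) (hq : ∀ n : ℕ, 0 < n → q ^ n ≠ 1) {m n : ℤ}
    (h : q ^ m = q ^ n) : m = n := by
  by_contra hne
  refine zpow_ne_one_of_pow_ne_one hq (sub_ne_zero.mpr hne) ?_
  rw [zpow_sub₀ hq0, h, div_self (zpow_ne_zero _ hq0)]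

end Strings

/-! ### Entries of the model matrices -/

section Models

open Module

set_option linter.unusedSimpArgs false

variable {K : Type*} [Field K] {d : ℕ} {q r : K}

theorem exists_entry_eq {n : ℕ} {i j : ℤ} (hi : 0 ≤ i) (hi' : i < n) (hj : 0 ≤ j)
    (hj' : j < n) (M : Matrix (Fin n) (Fin n) K) :
    ∃ k l : Fin n, ((k : ℕ) : ℤ) = i ∧ ((l : ℕ) : ℤ) = j ∧ entry M i j = M k l := by
  obtain ⟨k, rfl⟩ := exists_fin_eq hi hi'
  obtain ⟨l, rfl⟩ := exists_fin_eq hj hj'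
  exact ⟨k, l, rfl, rfl, entry_coe M k l⟩

theorem matA₁_tridiagonal (i j : Fin (d + 1)) (h : (i : ℕ) + 1 < j ∨ (j : ℕ) + 1 < i) :
    matA₁ d q r i j = 0 := by
  simp only [matA₁, Matrix.of_apply]
  rw [if_neg (by omega), if_neg (by omega)]

/-- At i = d the numerator vanishes, in agreement with the extension by zero. -/
theorem entry_matA₁_super {i : ℤ} (hi : 0 ≤ i) (hid : i ≤ d) :
    entry (matA₁ d q r) i (i + 1) = r * ((q ^ (2 * (d : ℤ) - 2 * i) - q ^ (2 * i - 2 * (d : ℤ))) /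
      (q ^ ((d : ℤ) - 2 * i) + q ^ (2 * i - (d : ℤ)))) := by
  rcases hid.eq_or_lt with rfl | h
  · rw [entry_of_col_ge _ _ (by push_cast; omega)]
    simp
  · obtain ⟨k, l, rfl, hl, he⟩ := exists_entry_eq (n := d + 1) hi (by push_cast; omega)
      (j := i + 1) (by omega) (by push_cast; omega) (matA₁ d q r)
    rw [he]
    simp only [matA₁, Matrix.of_apply]
    rw [if_pos (by omega)]

theorem entry_matA₁_sub {i : ℤ} (hi : 0 ≤ i) (hid : i ≤ d) :
    entry (matA₁ d q r) i (i - 1) = r * ((q ^ (2 * i) - q ^ (-2 * i)) /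
      (q ^ ((d : ℤ) - 2 * i) + q ^ (2 * i - (d : ℤ)))) := by
  rcases hi.eq_or_lt with rfl | h
  · rw [entry_of_col_neg _ _ (by omega)]
    simp
  · obtain ⟨k, l, rfl, hl, he⟩ := exists_entry_eq (n := d + 1) hi (by push_cast; omega)
      (j := i - 1) (by omega) (by push_cast; omega) (matA₁ d q r)
    rw [he]
    simp only [matA₁, Matrix.of_apply]
    rw [if_neg (by omega), if_pos (by omega)]

theorem entry_matA₁_diag (i : ℤ) : entry (matA₁ d q r) i i = 0 := by
  rcases lt_or_ge i 0 with h | h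
  · exact entry_of_row_neg _ _ h
  rcases lt_or_ge i ((d + 1 : ℕ) : ℤ) with h' | h'
  · obtain ⟨k, rfl⟩ := exists_fin_eq h h'
    rw [entry_coe]
    simp [matA₁]
  · exact entry_of_row_ge _ _ h'

theorem zpow_add_zpow_ne_zero (h2 : (2 : K) ≠ 0) (hq0 : q ≠ 0)
    (hq : ∀ n : ℕ, 0 < n → q ^ n ≠ 1) (m n : ℤ) : q ^ m + q ^ n ≠ 0 := by
  intro h
  refine zpow_ne_neg_one h2 hq (m - n) ?_
  rw [zpow_sub₀ hq0, div_eq_iff (zpow_ne_zero _ hq0)]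
  linear_combination h

theorem zpow_sub_zpow_ne_zero (hq0 : q ≠ 0)
    (hq : ∀ n : ℕ, 0 < n → q ^ n ≠ 1) {m n : ℤ} (hmn : m ≠ n) : q ^ m - q ^ n ≠ 0 :=
  fun h => hmn (zpow_inj_of_pow_ne_one hq0 hq (sub_eq_zero.mp h))

theorem matA₁_irreducible (h2 : (2 : K) ≠ 0) (hq0 : q ≠ 0) (hq : ∀ n : ℕ, 0 < n → q ^ n ≠ 1)
    (hr : r ^ 2 = -1) : IsIrreducibleTridiagonal (matA₁ d q r) := by
  have hr0 : r ≠ 0 := by rintro rfl; norm_num at hr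
  refine ⟨matA₁_tridiagonal, fun i j hij => ?_⟩
  have hd := zpow_add_zpow_ne_zero h2 hq0 hq
  constructor
  · have h := entry_matA₁_super (q := q) (r := r) (d := d) (i := (i : ℕ)) (by omega) (by omega)
    rw [show (((i : ℕ) : ℤ) + 1) = (j : ℕ) by omega, entry_coe] at h
    rw [h]
    exact mul_ne_zero hr0 (div_ne_zero (zpow_sub_zpow_ne_zero hq0 hq (by omega)) (hd _ _))
  · have h := entry_matA₁_sub (q := q) (r := r) (d := d) (i := (j : ℕ)) (by omega) (by omega)
    rw [show (((j : ℕ) : ℤ) - 1) = (i : ℕ) by omega, entry_coe] at h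
    rw [h]
    exact mul_ne_zero hr0 (div_ne_zero (zpow_sub_zpow_ne_zero hq0 hq (by omega)) (hd _ _))

theorem inv_eq_neg_of_sq (hr : r ^ 2 = -1) : r⁻¹ = -r :=
  inv_eq_of_mul_eq_one_right (by linear_combination -hr)

/-- The diagonal of `matA₁s` is the string with u = -r q^{-d}: since r⁻¹ = -r, the inverse of u is r
q^d. -/
theorem string₁_term (hq0 : q ≠ 0) (j : ℤ) :
    -r * q ^ (-(d : ℤ)) * q ^ (2 * j) = -r * q ^ (2 * j - (d : ℤ)) := by
  rw [mul_assoc, ← zpow_add₀ hq0, neg_add_eq_sub]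

theorem string₁_term_inv (hq0 : q ≠ 0) (hr : r ^ 2 = -1) (j : ℤ) :
    (-r * q ^ (-(d : ℤ)) * q ^ (2 * j))⁻¹ = r * q ^ ((d : ℤ) - 2 * j) := by
  rw [string₁_term hq0, mul_inv, ← zpow_neg, neg_sub, inv_neg, inv_eq_neg_of_sq hr, neg_neg]

theorem stringSum₁ (hq0 : q ≠ 0) (hr : r ^ 2 = -1) (j : ℤ) :
    stringSum (-r * q ^ (-(d : ℤ))) q j = r * (q ^ ((d : ℤ) - 2 * j) - q ^ (2 * j - (d : ℤ))) := by
  rw [stringSum, string₁_term_inv hq0 hr, string₁_term hq0]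
  ring

theorem stringDiff₁ (hq0 : q ≠ 0) (hr : r ^ 2 = -1) (j : ℤ) :
    stringDiff (-r * q ^ (-(d : ℤ))) q j =
      -r * (q ^ ((d : ℤ) - 2 * j) + q ^ (2 * j - (d : ℤ))) := by
  rw [stringDiff, string₁_term_inv hq0 hr, string₁_term hq0]
  ring

/-- Constant row sums make the all-ones vector an eigenvector of `matA₁`, for the first value of the
string. -/
theorem matA₁_row_sum (h2 : (2 : K) ≠ 0) (hq0 : q ≠ 0) (hq : ∀ n : ℕ, 0 < n → q ^ n ≠ 1)
    (hr : r ^ 2 = -1) {i : ℤ} (hi : 0 ≤ i) (hid : i ≤ d) :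
    entry (matA₁ d q r) i (i + 1) + entry (matA₁ d q r) i (i - 1) =
      stringSum (-r * q ^ (-(d : ℤ))) q 0 := by
  rw [entry_matA₁_super hi hid, entry_matA₁_sub hi hid, stringSum₁ hq0 hr, ← mul_add, ← add_div]
  congr 1
  rw [div_eq_iff (zpow_add_zpow_ne_zero h2 hq0 hq _ _)]
  simp only [mul_zero, sub_zero, zero_sub, zpow_sub₀ hq0, zpow_neg, neg_mul, zpow_mul', zpow_ofNat]
  have hD : q ^ (d : ℤ) ≠ 0 := zpow_ne_zero _ hq0
  have hJ : q ^ i ≠ 0 := zpow_ne_zero _ hq0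
  generalize q ^ (d : ℤ) = D at *
  generalize q ^ i = J at *
  field_simp
  ring

/-- This makes the image of the all-ones vector under `matA₁s` an eigenvector of `matA₁`, for the
second value of the string. -/
theorem matA₁_row_sum_mul (h2 : (2 : K) ≠ 0) (hq0 : q ≠ 0) (hq : ∀ n : ℕ, 0 < n → q ^ n ≠ 1)
    (hr : r ^ 2 = -1) {i : ℤ} (hi : 0 ≤ i) (hid : i ≤ d) :
    entry (matA₁ d q r) i (i + 1) * stringSum (-r * q ^ (-(d : ℤ))) q (i + 1) +
      entry (matA₁ d q r) i (i - 1) * stringSum (-r * q ^ (-(d : ℤ))) q (i - 1) =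
      stringSum (-r * q ^ (-(d : ℤ))) q 1 * stringSum (-r * q ^ (-(d : ℤ))) q i := by
  rw [entry_matA₁_super hi hid, entry_matA₁_sub hi hid]
  simp only [stringSum₁ hq0 hr]
  have hE := zpow_add_zpow_ne_zero h2 hq0 hq ((d : ℤ) - 2 * i) (2 * i - d)
  rw [mul_div_assoc', mul_div_assoc', div_mul_eq_mul_div, div_mul_eq_mul_div, ← add_div,
    div_eq_iff hE]
  simp only [mul_add, mul_sub, zpow_sub₀ hq0, zpow_add₀ hq0, zpow_neg, neg_mul, zpow_mul',
    zpow_ofNat, zpow_one]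
  have hD : q ^ (d : ℤ) ≠ 0 := zpow_ne_zero _ hq0
  have hJ : q ^ i ≠ 0 := zpow_ne_zero _ hq0
  clear hE
  generalize q ^ (d : ℤ) = D at *
  generalize q ^ i = J at *
  field_simp
  ring

/-- This is the telescoped diagonal relation summed from row 0. At j = d + 1 the left side is zero,
and the right side vanishes because u² q^{2d} = -1. -/
theorem matA₁_mul (h2 : (2 : K) ≠ 0) (hq0 : q ≠ 0) (hq : ∀ n : ℕ, 0 < n → q ^ n ≠ 1)
    (hr : r ^ 2 = -1) {j : ℤ} (hj : 0 ≤ j) (hjd : j ≤ d + 1) :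
    entry (matA₁ d q r) (j - 1) j * entry (matA₁ d q r) j (j - 1) *
      (stringDiff (-r * q ^ (-(d : ℤ))) q j * stringDiff (-r * q ^ (-(d : ℤ))) q (j - 1)) =
      stringGap (-r * q ^ (-(d : ℤ))) q j - stringGap (-r * q ^ (-(d : ℤ))) q 0 := by
  have hr4 : r ^ 4 = 1 := by linear_combination (r ^ 2 - 1) * hr
  rcases hj.eq_or_lt with rfl | h0
  · rw [entry_of_row_neg _ _ (by omega)]
    ring
  have hD : q ^ (d : ℤ) ≠ 0 := zpow_ne_zero _ hq0
  have hJ : q ^ j ≠ 0 := zpow_ne_zero _ hq0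
  have hr0 : r ≠ 0 := by rintro rfl; norm_num at hr
  have hgap : ∀ z, stringGap (-r * q ^ (-(d : ℤ))) q z =
      -((q ^ (2 * z - (d : ℤ))) ^ 2 * (q ^ 2)⁻¹ + (q ^ ((d : ℤ) - 2 * z)) ^ 2 * q ^ 2) := by
    intro z
    rw [stringGap, ← inv_pow (-r * q ^ (-(d : ℤ)) * q ^ (2 * z)), string₁_term_inv hq0 hr,
      string₁_term hq0, mul_pow, mul_pow, neg_sq, hr]
    ring
  rcases hjd.eq_or_lt with rfl | h1
  · rw [entry_of_col_ge _ _ (by push_cast; omega), hgap, hgap]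
    simp only [mul_add, mul_sub, zpow_sub₀ hq0, zpow_add₀ hq0, zpow_neg, neg_mul, zpow_mul',
      zpow_ofNat, zpow_one, mul_zero, zero_sub, sub_zero]
    generalize q ^ (d : ℤ) = D at *
    field_simp
    ring
  · have e := entry_matA₁_super (q := q) (r := r) (d := d) (i := j - 1) (by omega) (by omega)
    rw [sub_add_cancel] at e
    rw [e, entry_matA₁_sub hj (by omega), stringDiff₁ hq0 hr, stringDiff₁ hq0 hr]
    have hE := zpow_add_zpow_ne_zero h2 hq0 hq ((d : ℤ) - 2 * j) (2 * j - d)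
    have hE' := zpow_add_zpow_ne_zero h2 hq0 hq ((d : ℤ) - 2 * (j - 1)) (2 * (j - 1) - d)
    have cancel : ∀ X Y E E' : K, E ≠ 0 → E' ≠ 0 →
        r * (X / E') * (r * (Y / E)) * (-r * E * (-r * E')) = X * Y := by
      intro X Y E E' hE hE'
      field_simp
      linear_combination X * Y * hr4
    rw [cancel _ _ _ _ hE hE', hgap, hgap]
    simp only [mul_add, mul_sub, zpow_sub₀ hq0, zpow_add₀ hq0, zpow_neg, neg_mul, zpow_mul',
      zpow_ofNat, zpow_one, mul_zero, zero_sub, sub_zero]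
    clear hE hE'
    generalize q ^ (d : ℤ) = D at *
    generalize q ^ j = J at *
    field_simp
    ring

theorem matA₂_tridiagonal (i j : Fin (d + 1)) (h : (i : ℕ) + 1 < j ∨ (j : ℕ) + 1 < i) :
    matA₂ d q i j = 0 := by
  simp only [matA₂, Matrix.of_apply]
  rw [if_neg (by omega), if_neg (by omega), if_neg (by omega)]

theorem entry_matA₂_super {i : ℤ} (hi : 0 ≤ i) (hid : i ≤ d) :
    entry (matA₂ d q) i (i + 1) = (q ^ (2 * (d : ℤ) - 2 * i) - q ^ (2 * i - 2 * (d : ℤ))) /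
        (q ^ (-2 * i - 1) - q ^ (2 * i + 1)) := by
  rcases hid.eq_or_lt with rfl | h
  · rw [entry_of_col_ge _ _ (by push_cast; omega)]
    simp
  · obtain ⟨k, l, rfl, hl, he⟩ := exists_entry_eq (n := d + 1) hi (by push_cast; omega)
      (j := i + 1) (by omega) (by push_cast; omega) (matA₂ d q)
    rw [he]
    simp only [matA₂, Matrix.of_apply]
    rw [if_neg (by omega), if_pos (by omega)]

/-- Row 0 is excluded: there the numerator does not vanish, and the corner entry takes the place of
the missing term in the row sums. -/
theorem entry_matA₂_sub {i : ℤ} (hi : 0 < i) (hid : i ≤ d) :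
    entry (matA₂ d q) i (i - 1) =
      (q ^ (2 * (d : ℤ) + 2 * i + 2) - q ^ (-2 * (d : ℤ) - 2 * i - 2)) /
        (q ^ (2 * i + 1) - q ^ (-2 * i - 1)) := by
  obtain ⟨k, l, rfl, hl, he⟩ := exists_entry_eq (n := d + 1) hi.le (by push_cast; omega)
    (j := i - 1) (by omega) (by push_cast; omega) (matA₂ d q)
  rw [he]
  simp only [matA₂, Matrix.of_apply]
  rw [if_neg (by omega), if_neg (by omega), if_pos (by omega)]

theorem entry_matA₂_zero :
    entry (matA₂ d q) 0 0 = (q ^ (2 * (d : ℤ) + 2) - q ^ (-2 * (d : ℤ) - 2)) / (q - q⁻¹) := by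
  have := entry_coe (matA₂ d q) 0 0
  simp only [Fin.val_zero, Nat.cast_zero] at this
  rw [this]
  simp [matA₂]

theorem entry_matA₂_diag {i : ℤ} (hi : i ≠ 0) : entry (matA₂ d q) i i = 0 := by
  rcases lt_or_ge i 0 with h | h
  · exact entry_of_row_neg _ _ h
  rcases lt_or_ge i ((d + 1 : ℕ) : ℤ) with h' | h'
  · obtain ⟨k, rfl⟩ := exists_fin_eq h h'
    rw [entry_coe]
    simp only [matA₂, Matrix.of_apply]
    rw [if_neg (by omega), if_neg (by omega), if_neg (by omega)]
  · exact entry_of_row_ge _ _ h'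

theorem matA₂_irreducible (hq0 : q ≠ 0) (hq : ∀ n : ℕ, 0 < n → q ^ n ≠ 1) :
    IsIrreducibleTridiagonal (matA₂ d q) := by
  refine ⟨matA₂_tridiagonal, fun i j hij => ?_⟩
  constructor
  · have h := entry_matA₂_super (q := q) (d := d) (i := (i : ℕ)) (by omega) (by omega)
    rw [show (((i : ℕ) : ℤ) + 1) = (j : ℕ) by omega, entry_coe] at h
    rw [h]
    exact div_ne_zero (zpow_sub_zpow_ne_zero hq0 hq (by omega))
      (zpow_sub_zpow_ne_zero hq0 hq (by omega))
  · have h := entry_matA₂_sub (q := q) (d := d) (i := (j : ℕ)) (by omega) (by omega)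
    rw [show (((j : ℕ) : ℤ) - 1) = (i : ℕ) by omega, entry_coe] at h
    rw [h]
    exact div_ne_zero (zpow_sub_zpow_ne_zero hq0 hq (by omega))
      (zpow_sub_zpow_ne_zero hq0 hq (by omega))

theorem string₂_term (hq0 : q ≠ 0) (j : ℤ) : q * q ^ (2 * j) = q ^ (2 * j + 1) := by
  rw [zpow_add_one₀ hq0, mul_comm]

theorem stringSum₂ (hq0 : q ≠ 0) (j : ℤ) :
    stringSum q q j = q ^ (2 * j + 1) + q ^ (-2 * j - 1) := by
  rw [stringSum, string₂_term hq0, ← zpow_neg]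
  ring_nf

theorem stringDiff₂ (hq0 : q ≠ 0) (j : ℤ) :
    stringDiff q q j = q ^ (2 * j + 1) - q ^ (-2 * j - 1) := by
  rw [stringDiff, string₂_term hq0, ← zpow_neg]
  ring_nf

theorem stringGap₂ (hq0 : q ≠ 0) (j : ℤ) : stringGap q q j = q ^ (4 * j) + q ^ (-4 * j) := by
  have hJ : q ^ j ≠ 0 := zpow_ne_zero _ hq0
  rw [stringGap, string₂_term hq0]
  simp only [mul_add, mul_sub, zpow_sub₀ hq0, zpow_add₀ hq0, zpow_neg, neg_mul, zpow_mul',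
      zpow_ofNat, zpow_one]
  field_simp

theorem sub_inv_self_ne_zero (hq0 : q ≠ 0) (hq : ∀ n : ℕ, 0 < n → q ^ n ≠ 1) : q - q⁻¹ ≠ 0 :=
  sub_inv_ne_zero hq0 (hq 2 (by omega))

/-- The eigenvalues of `matA₂` are those of `matA₂s` read backwards, so their string starts at u =
q^{-2d-1}. -/
theorem matA₂_row_sum_of_pos (hq0 : q ≠ 0) (hq : ∀ n : ℕ, 0 < n → q ^ n ≠ 1)
    {i : ℤ} (hi : 0 < i) (hid : i ≤ d) :
    entry (matA₂ d q) i (i + 1) + entry (matA₂ d q) i (i - 1) =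
      stringSum (q ^ (-2 * (d : ℤ) - 1)) q 0 := by
  have hE : q ^ (2 * i + 1) - q ^ (-2 * i - 1) ≠ 0 := zpow_sub_zpow_ne_zero hq0 hq (by omega)
  rw [entry_matA₂_super hi.le hid, entry_matA₂_sub hi hid, stringSum,
    ← neg_sub (q ^ (2 * i + 1)) (q ^ (-2 * i - 1)), div_neg, ← neg_div, ← add_div, div_eq_iff hE]
  simp only [mul_add, mul_sub, zpow_sub₀ hq0, zpow_add₀ hq0, zpow_neg, neg_mul, zpow_mul',
    zpow_ofNat, zpow_one, mul_zero, zpow_zero, mul_one]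
  have hD : q ^ (d : ℤ) ≠ 0 := zpow_ne_zero _ hq0
  have hJ : q ^ i ≠ 0 := zpow_ne_zero _ hq0
  clear hE
  generalize q ^ (d : ℤ) = D at *
  generalize q ^ i = J at *
  field_simp
  ring

theorem matA₂_row_sum_zero (hq0 : q ≠ 0) (hq : ∀ n : ℕ, 0 < n → q ^ n ≠ 1) :
    entry (matA₂ d q) 0 1 + entry (matA₂ d q) 0 0 = stringSum (q ^ (-2 * (d : ℤ) - 1)) q 0 := by
  have hE := sub_inv_self_ne_zero hq0 hq
  have h := entry_matA₂_super (d := d) (q := q) (le_refl 0) (by omega)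
  simp only [mul_zero, zero_add, sub_zero, zero_sub, zpow_one, zpow_neg_one] at h
  rw [h, entry_matA₂_zero, stringSum, ← neg_sub q, div_neg, ← neg_div, ← add_div, div_eq_iff hE]
  simp only [mul_add, mul_sub, zpow_sub₀ hq0, zpow_add₀ hq0, zpow_neg, neg_mul, zpow_mul',
    zpow_ofNat, zpow_one, mul_zero, zpow_zero, mul_one]
  have hD : q ^ (d : ℤ) ≠ 0 := zpow_ne_zero _ hq0
  clear hE h
  generalize q ^ (d : ℤ) = D at *
  field_simp
  ring

theorem matA₂_row_sum_mul_of_pos (hq0 : q ≠ 0) (hq : ∀ n : ℕ, 0 < n → q ^ n ≠ 1)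
    {i : ℤ} (hi : 0 < i) (hid : i ≤ d) :
    entry (matA₂ d q) i (i + 1) * stringSum q q (i + 1) +
      entry (matA₂ d q) i (i - 1) * stringSum q q (i - 1) =
      stringSum (q ^ (-2 * (d : ℤ) - 1)) q 1 * stringSum q q i := by
  have hE : q ^ (2 * i + 1) - q ^ (-2 * i - 1) ≠ 0 := zpow_sub_zpow_ne_zero hq0 hq (by omega)
  rw [entry_matA₂_super hi.le hid, entry_matA₂_sub hi hid, stringSum₂ hq0, stringSum₂ hq0,
    stringSum₂ hq0, stringSum,
    ← neg_sub (q ^ (2 * i + 1)) (q ^ (-2 * i - 1)), div_neg, ← neg_div, div_mul_eq_mul_div,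
    div_mul_eq_mul_div, ← add_div, div_eq_iff hE]
  simp only [mul_add, mul_sub, zpow_sub₀ hq0, zpow_add₀ hq0, zpow_neg, neg_mul, zpow_mul',
    zpow_ofNat, zpow_one, mul_zero, zpow_zero, mul_one]
  have hD : q ^ (d : ℤ) ≠ 0 := zpow_ne_zero _ hq0
  have hJ : q ^ i ≠ 0 := zpow_ne_zero _ hq0
  clear hE
  generalize q ^ (d : ℤ) = D at *
  generalize q ^ i = J at *
  field_simp
  ring

theorem matA₂_row_sum_mul_zero (hq0 : q ≠ 0) (hq : ∀ n : ℕ, 0 < n → q ^ n ≠ 1) :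
    entry (matA₂ d q) 0 1 * stringSum q q 1 + entry (matA₂ d q) 0 0 * stringSum q q 0 =
      stringSum (q ^ (-2 * (d : ℤ) - 1)) q 1 * stringSum q q 0 := by
  have hE := sub_inv_self_ne_zero hq0 hq
  have h := entry_matA₂_super (d := d) (q := q) (le_refl 0) (by omega)
  simp only [mul_zero, zero_add, sub_zero, zero_sub, zpow_one, zpow_neg_one] at h
  rw [h, entry_matA₂_zero, stringSum₂ hq0, stringSum₂ hq0, stringSum, ← neg_sub q, div_neg,
    ← neg_div, div_mul_eq_mul_div, div_mul_eq_mul_div, ← add_div, div_eq_iff hE]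
  simp only [mul_add, mul_sub, zpow_sub₀ hq0, zpow_add₀ hq0, zpow_neg, neg_mul, zpow_mul',
    zpow_ofNat, zpow_one, mul_zero, zpow_zero, mul_one]
  have hD : q ^ (d : ℤ) ≠ 0 := zpow_ne_zero _ hq0
  clear hE h
  generalize q ^ (d : ℤ) = D at *
  field_simp
  ring

/-- The telescoped relation is summed from the last row, because the corner entry contributes to row
0. -/
theorem matA₂_mul (hq0 : q ≠ 0) (hq : ∀ n : ℕ, 0 < n → q ^ n ≠ 1)
    {j : ℤ} (hj : 0 < j) (hjd : j ≤ d + 1) :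
    entry (matA₂ d q) (j - 1) j * entry (matA₂ d q) j (j - 1) *
      (stringDiff q q j * stringDiff q q (j - 1)) =
      stringGap q q j - stringGap q q (d + 1) := by
  rcases hjd.eq_or_lt with rfl | h1
  · rw [entry_of_col_ge _ _ (by push_cast; omega)]
    ring
  have e := entry_matA₂_super (q := q) (d := d) (i := j - 1) (by omega) (by omega)
  rw [sub_add_cancel] at e
  rw [e, entry_matA₂_sub hj (by omega), stringDiff₂ hq0, stringDiff₂ hq0]
  have hE : q ^ (2 * j + 1) - q ^ (-2 * j - 1) ≠ 0 := zpow_sub_zpow_ne_zero hq0 hq (by omega)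
  have hE' : q ^ (2 * (j - 1) + 1) - q ^ (-2 * (j - 1) - 1) ≠ 0 :=
    zpow_sub_zpow_ne_zero hq0 hq (by omega)
  have cancel : ∀ X Y E E' : K, E ≠ 0 → E' ≠ 0 →
      X / (-E') * (Y / E) * (E * E') = -(X * Y) := by
    intro X Y E E' hE hE'
    field_simp
  rw [← neg_sub (q ^ (2 * (j - 1) + 1)), cancel _ _ _ _ hE hE', stringGap₂ hq0, stringGap₂ hq0]
  simp only [mul_add, mul_sub, zpow_sub₀ hq0, zpow_add₀ hq0, zpow_neg, neg_mul, zpow_mul',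
    zpow_ofNat, zpow_one, mul_one]
  have hD : q ^ (d : ℤ) ≠ 0 := zpow_ne_zero _ hq0
  have hJ : q ^ j ≠ 0 := zpow_ne_zero _ hq0
  clear hE hE'
  generalize q ^ (d : ℤ) = D at *
  generalize q ^ j = J at *
  field_simp
  ring

end Models

/-! ### The models are Leonard pairs satisfying the relations -/

section ModelPairs

open Module

variable {K V : Type*} [Field K] [AddCommGroup V] [Module K V] {d : ℕ} {q r : K}

theorem apply_zext_of_apply_basis {n : ℕ} {b : Basis (Fin n) K V} {As : End K V} {θ : ℤ → K}
    (hAs : ∀ k : Fin n, As (b k) = θ (k : ℕ) • b k) (j : ℤ) :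
    As (zext b j) = θ j • zext b j := by
  rcases lt_or_ge j 0 with h | h
  · simp [zext_of_neg _ h]
  rcases lt_or_ge j n with h' | h'
  · obtain ⟨k, rfl⟩ := exists_fin_eq h h'
    rw [zext_coe, hAs]
  · simp [zext_of_ge _ h']

/-- Sufficient conditions on the entries for a tridiagonal and a diagonal map to satisfy the
Askey-Wilson relations. -/
theorem satisfiesAW_of_entry {b : Basis (Fin (d + 1)) K V} {A As : End K V} {θ : ℤ → K} {β ρ : K}
    {M : Matrix (Fin (d + 1)) (Fin (d + 1)) K} (hM : LinearMap.toMatrix b b A = M)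
    (htri : ∀ i j : Fin (d + 1), (i : ℕ) + 1 < j ∨ (j : ℕ) + 1 < i → M i j = 0)
    (hAs : ∀ k : Fin (d + 1), As (b k) = θ (k : ℕ) • b k)
    (hrec : ∀ j, θ j + θ (j + 2) = β * θ (j + 1))
    (hsq : ∀ j, θ j ^ 2 - β * θ j * θ (j + 1) + θ (j + 1) ^ 2 = ρ)
    (hoff : ∀ j : ℤ, 0 ≤ j → j < d → (entry M j j + entry M (j + 1) (j + 1)) * (θ j + θ (j + 1)) -
      β * (entry M j j * θ j + entry M (j + 1) (j + 1) * θ (j + 1)) = 0)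
    (hdiag : ∀ j : ℤ, 0 ≤ j → j ≤ d →
      2 * θ j * (entry M (j - 1) j * entry M j (j - 1) + entry M j (j + 1) * entry M (j + 1) j +
        entry M j j ^ 2) - β * (entry M (j - 1) j * entry M j (j - 1) * θ (j - 1) +
        entry M j (j + 1) * entry M (j + 1) j * θ (j + 1) + entry M j j ^ 2 * θ j) - ρ * θ j = 0)
    (ha : ∀ j, entry M j j * ((2 - β) * θ j ^ 2 - ρ) = 0) :
    SatisfiesAW β 0 0 ρ ρ 0 0 0 A As := by
  subst hM
  have hA := apply_zext htri
  have hAs' := apply_zext_of_apply_basis hAs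
  set M := LinearMap.toMatrix b b A
  rw [satisfiesAW_iff]
  constructor
  · refine b.ext fun k => ?_
    have h1 : entry M (((k : ℕ) : ℤ) + 1) (k : ℕ) *
        ((entry M (k : ℕ) (k : ℕ) + entry M ((k : ℕ) + 1) ((k : ℕ) + 1)) *
          (θ (k : ℕ) + θ ((k : ℕ) + 1)) - β * (entry M (k : ℕ) (k : ℕ) * θ (k : ℕ) +
            entry M ((k : ℕ) + 1) ((k : ℕ) + 1) * θ ((k : ℕ) + 1))) = 0 := by
      rcases lt_or_ge ((k : ℕ) : ℤ) d with h | h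
      · rw [hoff _ (by omega) h, mul_zero]
      · rw [entry_of_row_ge _ _ (by push_cast; omega), zero_mul]
    have h2 : entry M (((k : ℕ) : ℤ) - 1) (k : ℕ) *
        ((entry M (k : ℕ) (k : ℕ) + entry M ((k : ℕ) - 1) ((k : ℕ) - 1)) *
          (θ (k : ℕ) + θ ((k : ℕ) - 1)) - β * (entry M (k : ℕ) (k : ℕ) * θ (k : ℕ) +
            entry M ((k : ℕ) - 1) ((k : ℕ) - 1) * θ ((k : ℕ) - 1))) = 0 := by
      rcases lt_or_ge 0 ((k : ℕ) : ℤ) with h | h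
      · have := hoff ((k : ℕ) - 1) (by omega) (by omega)
        rw [sub_add_cancel] at this
        refine mul_eq_zero_of_right _ ?_
        linear_combination this
      · rw [entry_of_row_neg _ _ (by omega), zero_mul]
    have h3 := hrec ((k : ℕ) - 2)
    rw [sub_add_cancel, show ((k : ℕ) : ℤ) - 2 + 1 = (k : ℕ) - 1 by ring, add_comm] at h3
    rw [← zext_coe b k, aw_left_apply hA hAs', h1, h2, hrec, h3, sub_add_cancel,
      add_sub_cancel_right, hdiag _ (by omega) (by omega)]
    simp
  · refine b.ext fun k => ?_
    have h3 := hsq ((k : ℕ) - 1)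
    rw [sub_add_cancel] at h3
    rw [← zext_coe b k, aw_right_apply hA hAs', hsq, ha,
      show θ ((k : ℕ) : ℤ) ^ 2 - β * θ ((k : ℕ) : ℤ) * θ (((k : ℕ) : ℤ) - 1) +
        θ (((k : ℕ) : ℤ) - 1) ^ 2 = ρ by linear_combination h3]
    simp

theorem toMatrix_basisFun_toLin' (N : Matrix (Fin (d + 1)) (Fin (d + 1)) K) :
    LinearMap.toMatrix (Pi.basisFun K (Fin (d + 1))) (Pi.basisFun K (Fin (d + 1)))
      (Matrix.toLin' N) = N := by
  rw [LinearMap.toMatrix_eq_toMatrix', LinearMap.toMatrix'_toLin']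

theorem toLin'_diagonal_basisFun (f : Fin (d + 1) → K) (k : Fin (d + 1)) :
    Matrix.toLin' (Matrix.diagonal f) (Pi.basisFun K (Fin (d + 1)) k) =
      f k • Pi.basisFun K (Fin (d + 1)) k := by
  have h := apply_basis_of_isDiag (b := Pi.basisFun K (Fin (d + 1)))
    (A := Matrix.toLin' (Matrix.diagonal f))
    (by rw [toMatrix_basisFun_toLin']; exact Matrix.isDiag_diagonal f) k
  rwa [toMatrix_basisFun_toLin', Matrix.diagonal_apply_eq] at h

theorem matA₁s_eq (hq0 : q ≠ 0) (hr : r ^ 2 = -1) :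
    matA₁s d q r = Matrix.diagonal fun j : Fin (d + 1) => stringSum (-r * q ^ (-(d : ℤ))) q (j : ℕ) := by
  simp only [matA₁s, stringSum₁ hq0 hr]

theorem matA₂s_eq (hq0 : q ≠ 0) :
    matA₂s d q = Matrix.diagonal fun j : Fin (d + 1) => stringSum q q (j : ℕ) := by
  simp only [matA₂s, stringSum₂ hq0]

theorem stringDiff₁_ne_zero (h2 : (2 : K) ≠ 0) (hq0 : q ≠ 0) (hq : ∀ n : ℕ, 0 < n → q ^ n ≠ 1)
    (hr : r ^ 2 = -1) (j : ℤ) : stringDiff (-r * q ^ (-(d : ℤ))) q j ≠ 0 := by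
  rw [stringDiff₁ hq0 hr]
  exact mul_ne_zero (neg_ne_zero.mpr (by rintro rfl; norm_num at hr))
    (zpow_add_zpow_ne_zero h2 hq0 hq _ _)

theorem stringDiff₂_ne_zero (hq0 : q ≠ 0) (hq : ∀ n : ℕ, 0 < n → q ^ n ≠ 1) (j : ℤ) :
    stringDiff q q j ≠ 0 := by
  rw [stringDiff₂ hq0]
  exact zpow_sub_zpow_ne_zero hq0 hq (by omega)

theorem string₁_ne_zero (hq0 : q ≠ 0) (hr : r ^ 2 = -1) : -r * q ^ (-(d : ℤ)) ≠ 0 :=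
  mul_ne_zero (neg_ne_zero.mpr (by rintro rfl; norm_num at hr)) (zpow_ne_zero _ hq0)

theorem satisfiesAW_matA₁ (h2 : (2 : K) ≠ 0) (hq0 : q ≠ 0) (hq : ∀ n : ℕ, 0 < n → q ^ n ≠ 1)
    (hr : r ^ 2 = -1) :
    SatisfiesAW (q ^ 2 + (q ^ 2)⁻¹) 0 0 (4 - (q ^ 2 + (q ^ 2)⁻¹) ^ 2)
      (4 - (q ^ 2 + (q ^ 2)⁻¹) ^ 2) 0 0 0
      (Matrix.toLin' (matA₁ d q r)) (Matrix.toLin' (matA₁s d q r)) := by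
  have hu := string₁_ne_zero (d := d) hq0 hr
  rw [matA₁s_eq hq0 hr]
  refine satisfiesAW_of_entry (θ := stringSum (-r * q ^ (-(d : ℤ))) q)
    (toMatrix_basisFun_toLin' _) matA₁_tridiagonal (toLin'_diagonal_basisFun _)
    (stringSum_add_two hu hq0) (stringSum_sq hu hq0) ?_ ?_ ?_
  · intro j _ _
    simp [entry_matA₁_diag]
  · intro j h0 hd
    refine (mul_eq_zero.mp ?_).resolve_left (stringDiff₁_ne_zero (d := d) h2 hq0 hq hr j)
    have e1 := matA₁_mul (d := d) h2 hq0 hq hr h0 (by omega)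
    have e2 := matA₁_mul (d := d) h2 hq0 hq hr (j := j + 1) (by omega) (by omega)
    rw [add_sub_cancel_right] at e2
    rw [stringDiff_mul_diagonal hu hq0, e1, e2, entry_matA₁_diag]
    ring
  · intro j
    rw [entry_matA₁_diag, zero_mul]

theorem stringSum_mul_stringDiff₂_zero (hq0 : q ≠ 0) :
    stringSum q q 0 * stringDiff q q 0 = q ^ 2 - (q ^ 2)⁻¹ := by
  simp only [stringSum, stringDiff, mul_zero, zpow_zero, mul_one]
  field_simp
  ring

/-- This is what row 0 of the telescoped relation demands once the products are known. -/
theorem corner_sq (hq0 : q ≠ 0) (hq : ∀ n : ℕ, 0 < n → q ^ n ≠ 1) :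
    (q ^ 2 + (q ^ 2)⁻¹ - 2) * entry (matA₂ d q) 0 0 ^ 2 =
      stringGap q q (d + 1) - stringGap q q 0 := by
  have hE := sub_inv_self_ne_zero hq0 hq
  rw [entry_matA₂_zero, stringGap₂ hq0, stringGap₂ hq0,
    show q ^ 2 + (q ^ 2)⁻¹ - 2 = (q - q⁻¹) ^ 2 by field_simp; ring, ← mul_pow,
    mul_div_cancel₀ _ hE]
  have hD : q ^ (d : ℤ) ≠ 0 := zpow_ne_zero _ hq0
  simp only [mul_add, neg_mul, zpow_neg, zpow_sub₀ hq0, zpow_add₀ hq0, zpow_mul', zpow_ofNat,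
    mul_one]
  generalize q ^ (d : ℤ) = D at *
  field_simp
  ring

theorem satisfiesAW_matA₂ (hq0 : q ≠ 0) (hq : ∀ n : ℕ, 0 < n → q ^ n ≠ 1) :
    SatisfiesAW (q ^ 2 + (q ^ 2)⁻¹) 0 0 (4 - (q ^ 2 + (q ^ 2)⁻¹) ^ 2)
      (4 - (q ^ 2 + (q ^ 2)⁻¹) ^ 2) 0 0 0
      (Matrix.toLin' (matA₂ d q)) (Matrix.toLin' (matA₂s d q)) := by
  rw [matA₂s_eq hq0]
  refine satisfiesAW_of_entry (θ := stringSum q q)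
    (toMatrix_basisFun_toLin' _) matA₂_tridiagonal (toLin'_diagonal_basisFun _)
    (stringSum_add_two hq0 hq0) (stringSum_sq hq0 hq0) ?_ ?_ ?_
  · intro j h0 hd
    rw [entry_matA₂_diag (i := j + 1) (by omega)]
    rcases h0.eq_or_lt with rfl | h
    -- For u = q the string satisfies θ_{-1} = θ_0, so the recurrence gives θ_0 + θ_1 = β θ_0.
    · simp only [stringSum₂ hq0, zero_add, mul_zero, mul_one]
      rw [show (-2 - 1 : ℤ) = -3 by norm_num, show (2 + 1 : ℤ) = 3 by norm_num,
        zero_sub, zpow_one, zpow_neg_one, zpow_neg, zpow_ofNat]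
      field_simp
      ring
    · rw [entry_matA₂_diag (by omega)]
      ring
  · intro j h0 hd
    refine (mul_eq_zero.mp ?_).resolve_left (stringDiff₂_ne_zero hq0 hq j)
    have e2 := matA₂_mul (d := d) hq0 hq (j := j + 1) (by omega) (by omega)
    rw [add_sub_cancel_right] at e2
    rw [stringDiff_mul_diagonal hq0 hq0, e2]
    rcases h0.eq_or_lt with rfl | h
    · rw [entry_of_row_neg _ _ (by omega), stringSum_mul_stringDiff₂_zero hq0]
      linear_combination -(q ^ 2 - (q ^ 2)⁻¹) * corner_sq (d := d) hq0 hq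
    · rw [matA₂_mul (d := d) hq0 hq h (by omega), entry_matA₂_diag (by omega)]
      ring
  · intro j
    rcases eq_or_ne j 0 with rfl | h
    -- Here θ_0² = (q + q⁻¹)² = 2 + β, and (2 - β)(2 + β) = ρ.
    · refine mul_eq_zero_of_right _ ?_
      simp only [stringSum, mul_zero, zpow_zero, mul_one]
      field_simp
      ring
    · rw [entry_matA₂_diag h, zero_mul]

theorem stringSum_ne_of_ne {u : K} (hu : u ≠ 0) (hq0 : q ≠ 0) (hq : ∀ n : ℕ, 0 < n → q ^ n ≠ 1)
    {i j : ℤ} (hij : i ≠ j) (hu2 : u ^ 2 * q ^ (2 * i + 2 * j) ≠ 1) :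
    stringSum u q i ≠ stringSum u q j := by
  intro h
  rcases add_inv_eq_add_inv (mul_ne_zero hu (zpow_ne_zero _ hq0))
    (mul_ne_zero hu (zpow_ne_zero _ hq0)) h with h | h
  · have := zpow_inj_of_pow_ne_one hq0 hq (mul_left_cancel₀ hu h)
    omega
  · apply hu2
    rw [zpow_add₀ hq0]
    linear_combination h

/-- As u² = -q^{-2d}, a coincidence would make a power of q equal to -1. -/
theorem stringSum₁_injective (h2 : (2 : K) ≠ 0) (hq0 : q ≠ 0) (hq : ∀ n : ℕ, 0 < n → q ^ n ≠ 1)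
    (hr : r ^ 2 = -1) : Function.Injective (stringSum (-r * q ^ (-(d : ℤ))) q) := by
  intro i j h
  by_contra hij
  refine stringSum_ne_of_ne (string₁_ne_zero hq0 hr) hq0 hq hij ?_ h
  rw [mul_pow, neg_sq, hr, ← zpow_natCast, ← zpow_mul, mul_assoc, ← zpow_add₀ hq0, neg_one_mul]
  intro h
  exact zpow_ne_neg_one h2 hq _ (neg_eq_iff_eq_neg.mp h)

theorem isLeonardPair_matA₁ (h2 : (2 : K) ≠ 0) (hq0 : q ≠ 0) (hq : ∀ n : ℕ, 0 < n → q ^ n ≠ 1)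
    (hr : r ^ 2 = -1) :
    IsLeonardPair (Matrix.toLin' (matA₁ d q r)) (Matrix.toLin' (matA₁s d q r)) := by
  have hu := string₁_ne_zero (d := d) hq0 hr
  have hinj := stringSum₁_injective (d := d) h2 hq0 hq hr
  have hAW := (satisfiesAW_iff.mp (satisfiesAW_matA₁ (d := d) h2 hq0 hq hr)).1
  have hv : Matrix.toLin' (matA₁s d q r) (fun _ => 1) =
      fun k : Fin (d + 1) => stringSum (-r * q ^ (-(d : ℤ))) q (k : ℕ) := by
    rw [matA₁s_eq hq0 hr, Matrix.toLin'_apply]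
    ext k
    simp [Matrix.mulVec_diagonal]
  refine isLeonardPair_of_eigenString (b := Pi.basisFun K (Fin (d + 1))) (v := fun _ => 1)
    (θs := fun k => stringSum (-r * q ^ (-(d : ℤ))) q (k : ℕ))
    (θ := fun n => stringSum (-r * q ^ (-(d : ℤ))) q n)
    ?_ ?_ ?_ hAW ?_ ?_ ?_ ?_ ?_ ?_ ?_
  · rw [toMatrix_basisFun_toLin']
    exact matA₁_irreducible h2 hq0 hq hr
  · rw [matA₁s_eq hq0 hr]
    exact toLin'_diagonal_basisFun _
  · intro i j h
    exact Fin.ext (by exact_mod_cast hinj h)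
  · intro n
    push_cast
    exact stringSum_add_two hu hq0 n
  · intro n
    push_cast
    exact stringSum_mul_add_two hu hq0 n
  · intro n h
    have := hinj h
    omega
  · intro i j hij _ _ h
    have := hinj h
    omega
  · intro h
    exact one_ne_zero (congrFun h 0)
  · rw [Matrix.toLin'_apply]
    ext i
    have := mulVec_eq (matA₁_tridiagonal (d := d) (q := q) (r := r)) (fun _ => 1) i
    rw [this, entry_matA₁_diag]
    have h := matA₁_row_sum (d := d) h2 hq0 hq hr (i := (i : ℕ)) (by omega) (by omega)
    simp only [mul_one, add_zero, Pi.smul_apply, smul_eq_mul, Nat.cast_zero]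
    exact h
  · rw [hv, Matrix.toLin'_apply]
    ext i
    rw [mulVec_eq matA₁_tridiagonal (stringSum (-r * q ^ (-(d : ℤ))) q), entry_matA₁_diag]
    have h := matA₁_row_sum_mul (d := d) h2 hq0 hq hr (i := (i : ℕ)) (by omega) (by omega)
    simp only [zero_mul, add_zero, Pi.smul_apply, smul_eq_mul, Nat.cast_one]
    exact h

theorem isLeonardPair_matA₂ (hq0 : q ≠ 0) (hq : ∀ n : ℕ, 0 < n → q ^ n ≠ 1) :
    IsLeonardPair (Matrix.toLin' (matA₂ d q)) (Matrix.toLin' (matA₂s d q)) := by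
  have hu : q ^ (-2 * (d : ℤ) - 1) ≠ 0 := zpow_ne_zero _ hq0
  have hAW := (satisfiesAW_iff.mp (satisfiesAW_matA₂ (d := d) hq0 hq)).1
  have hv : Matrix.toLin' (matA₂s d q) (fun _ => 1) =
      fun k : Fin (d + 1) => stringSum q q (k : ℕ) := by
    rw [matA₂s_eq hq0, Matrix.toLin'_apply]
    ext k
    simp [Matrix.mulVec_diagonal]
  -- Indices n and n + 2 have even sum, and i < d with j ≤ d + 1 has sum at most 2d. The excluded
  -- sum does occur for d and d + 1.
  have hne : ∀ i j : ℤ, i ≠ j → i + j ≠ 2 * d + 1 →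
      stringSum (q ^ (-2 * (d : ℤ) - 1)) q i ≠ stringSum (q ^ (-2 * (d : ℤ) - 1)) q j := by
    intro i j hij h
    refine stringSum_ne_of_ne hu hq0 hq hij ?_
    rw [← zpow_natCast, ← zpow_mul, ← zpow_add₀ hq0]
    exact zpow_ne_one_of_pow_ne_one hq (by push_cast; omega)
  refine isLeonardPair_of_eigenString (b := Pi.basisFun K (Fin (d + 1))) (v := fun _ => 1)
    (θs := fun k => stringSum q q (k : ℕ))
    (θ := fun n => stringSum (q ^ (-2 * (d : ℤ) - 1)) q n)
    ?_ ?_ ?_ hAW ?_ ?_ ?_ ?_ ?_ ?_ ?_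
  · rw [toMatrix_basisFun_toLin']
    exact matA₂_irreducible hq0 hq
  · rw [matA₂s_eq hq0]
    exact toLin'_diagonal_basisFun _
  · intro i j h
    by_contra hij
    refine stringSum_ne_of_ne hq0 hq0 hq (i := (i : ℕ)) (j := (j : ℕ)) (by omega) ?_ h
    rw [← zpow_natCast, ← zpow_add₀ hq0]
    exact zpow_ne_one_of_pow_ne_one hq (by push_cast; omega)
  · intro n
    push_cast
    exact stringSum_add_two hu hq0 n
  · intro n
    push_cast
    exact stringSum_mul_add_two hu hq0 n
  · intro n
    push_cast
    exact hne _ _ (by omega) (by omega)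
  · intro i j hij hj hi
    exact hne _ _ (by omega) (by omega)
  · intro h
    exact one_ne_zero (congrFun h 0)
  · rw [Matrix.toLin'_apply]
    ext i
    have := mulVec_eq (matA₂_tridiagonal (d := d) (q := q)) (fun _ => 1) i
    rw [this]
    simp only [mul_one, Pi.smul_apply, smul_eq_mul, Nat.cast_zero]
    rcases Nat.eq_zero_or_pos (i : ℕ) with h0 | h0
    · rw [h0, Nat.cast_zero, zero_add, entry_of_col_neg _ (0 : ℤ) (j := 0 - 1) (by omega),
        add_zero]
      exact matA₂_row_sum_zero hq0 hq
    · rw [entry_matA₂_diag (by omega), add_zero]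
      exact matA₂_row_sum_of_pos hq0 hq (by omega) (by omega)
  · rw [hv, Matrix.toLin'_apply]
    ext i
    rw [mulVec_eq matA₂_tridiagonal (stringSum q q)]
    simp only [Pi.smul_apply, smul_eq_mul, Nat.cast_one]
    rcases Nat.eq_zero_or_pos (i : ℕ) with h0 | h0
    · rw [h0, Nat.cast_zero, zero_add, entry_of_col_neg _ (0 : ℤ) (j := 0 - 1) (by omega),
        zero_mul, add_zero]
      exact matA₂_row_sum_mul_zero hq0 hq
    · rw [entry_matA₂_diag (by omega), zero_mul, add_zero]
      exact matA₂_row_sum_mul_of_pos hq0 hq (by omega) (by omega)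

end ModelPairs

/-! ### Exchange of the two maps and changes of sign -/

section Symmetries

open Module

variable {K V : Type*} [Field K] [AddCommGroup V] [Module K V]

theorem IsIrreducibleTridiagonal.neg {n : ℕ} {M : Matrix (Fin n) (Fin n) K}
    (h : IsIrreducibleTridiagonal M) : IsIrreducibleTridiagonal (-M) :=
  ⟨fun i j hij => by rw [Matrix.neg_apply, h.1 i j hij, neg_zero],
    fun i j hij => ⟨neg_ne_zero.mpr (h.2 i j hij).1, neg_ne_zero.mpr (h.2 i j hij).2⟩⟩

theorem IsLeonardPair.symm {A As : End K V} (h : IsLeonardPair A As) : IsLeonardPair As A := by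
  obtain ⟨⟨d, b, h1, h2⟩, ⟨d', b', h3, h4⟩⟩ := h
  exact ⟨⟨d', b', h4, h3⟩, ⟨d, b, h2, h1⟩⟩

theorem IsLeonardPair.neg_left {A As : End K V} (h : IsLeonardPair A As) :
    IsLeonardPair (-A) As := by
  obtain ⟨⟨d, b, h1, h2⟩, ⟨d', b', h3, h4⟩⟩ := h
  refine ⟨⟨d, b, ?_, h2⟩, ⟨d', b', ?_, h4⟩⟩
  · rw [map_neg]
    exact h1.neg
  · rw [map_neg]
    exact h3.neg

theorem IsLeonardPair.neg_right {A As : End K V} (h : IsLeonardPair A As) :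
    IsLeonardPair A (-As) :=
  h.symm.neg_left.symm

theorem SatisfiesAW.symm {β ρ : K} {A As : End K V} (h : SatisfiesAW β 0 0 ρ ρ 0 0 0 A As) :
    SatisfiesAW β 0 0 ρ ρ 0 0 0 As A := by
  rw [satisfiesAW_iff] at h ⊢
  exact h.symm

/-- With the remaining parameters zero, the first relation is even in `A` and the second is odd. -/
theorem SatisfiesAW.neg_left {β ρ : K} {A As : End K V} (h : SatisfiesAW β 0 0 ρ ρ 0 0 0 A As) :
    SatisfiesAW β 0 0 ρ ρ 0 0 0 (-A) As := by
  rw [satisfiesAW_iff] at h ⊢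
  refine ⟨by simpa using h.1, ?_⟩
  rw [← neg_eq_zero, ← h.2]
  simp only [mul_neg, neg_mul, smul_neg]
  abel

theorem SatisfiesAW.neg_right {β ρ : K} {A As : End K V} (h : SatisfiesAW β 0 0 ρ ρ 0 0 0 A As) :
    SatisfiesAW β 0 0 ρ ρ 0 0 0 A (-As) :=
  h.symm.neg_left.symm

end Symmetries

/-! ### Isomorphism of pairs -/

section Isomorphism

open Module

variable {K V W : Type*} [Field K] [AddCommGroup V] [Module K V] [AddCommGroup W] [Module K W]
  {d : ℕ}

theorem pairIsomorphic_of_intertwining {A As : End K V} {B Bs : End K W} (σ : V ≃ₗ[K] W)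
    (h : σ.toLinearMap ∘ₗ A = B ∘ₗ σ.toLinearMap)
    (hs : σ.toLinearMap ∘ₗ As = Bs ∘ₗ σ.toLinearMap) : PairIsomorphic A As B Bs := by
  refine ⟨σ, ?_, ?_⟩ <;> ext w
  · rw [LinearEquiv.conj_apply_apply]
    simpa using LinearMap.congr_fun h (σ.symm w)
  · rw [LinearEquiv.conj_apply_apply]
    simpa using LinearMap.congr_fun hs (σ.symm w)

theorem PairIsomorphic.symm {A As : End K V} {B Bs : End K W}
    (h : PairIsomorphic A As B Bs) : PairIsomorphic B Bs A As := by
  obtain ⟨σ, h1, h2⟩ := h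
  exact ⟨σ.symm, by rw [← h1, LinearEquiv.conj_symm_conj], by rw [← h2, LinearEquiv.conj_symm_conj]⟩

theorem PairIsomorphic.neg_left {A As : End K V} {B Bs : End K W}
    (h : PairIsomorphic A As B Bs) : PairIsomorphic (-A) As (-B) Bs := by
  obtain ⟨σ, h1, h2⟩ := h
  exact ⟨σ, by rw [map_neg, h1], h2⟩

theorem PairIsomorphic.neg_right {A As : End K V} {B Bs : End K W}
    (h : PairIsomorphic A As B Bs) : PairIsomorphic A (-As) B (-Bs) := by
  obtain ⟨σ, h1, h2⟩ := h
  exact ⟨σ, h1, by rw [map_neg, h2]⟩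

theorem PairIsomorphic.trace_left {A As : End K V} {B Bs : End K W}
    (h : PairIsomorphic A As B Bs) : LinearMap.trace K V A = LinearMap.trace K W B := by
  obtain ⟨σ, h1, _⟩ := h
  rw [← h1, LinearMap.trace_conj']

theorem PairIsomorphic.trace_right {A As : End K V} {B Bs : End K W}
    (h : PairIsomorphic A As B Bs) : LinearMap.trace K V As = LinearMap.trace K W Bs := by
  obtain ⟨σ, _, h2⟩ := h
  rw [← h2, LinearMap.trace_conj']

/-- The ratios of the diagonal change of basis that turns the subdiagonal of `M` into that
of `N`. -/
def subdiagonalScale {n : ℕ} (M N : Matrix (Fin n) (Fin n) K) (k : ℕ) : K :=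
  ∏ l ∈ Finset.range k, entry N (l + 1) l / entry M (l + 1) l

theorem subdiagonalScale_ne_zero {M N : Matrix (Fin (d + 1)) (Fin (d + 1)) K}
    (hM : IsIrreducibleTridiagonal M) (hN : IsIrreducibleTridiagonal N) (k : Fin (d + 1)) :
    subdiagonalScale M N k ≠ 0 := by
  refine Finset.prod_ne_zero_iff.mpr fun l hl => ?_
  rw [Finset.mem_range] at hl
  let i : Fin (d + 1) := ⟨l, by omega⟩
  let j : Fin (d + 1) := ⟨l + 1, by omega⟩
  have h1 : ∀ P : Matrix (Fin (d + 1)) (Fin (d + 1)) K, entry P (l + 1) l = P j i := fun P => by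
    rw [← entry_coe P j i]
    simp [i, j]
  rw [h1, h1]
  exact div_ne_zero (hN.2 i j rfl).2 (hM.2 i j rfl).2

theorem subdiagonalScale_succ {M N : Matrix (Fin (d + 1)) (Fin (d + 1)) K}
    {i j : Fin (d + 1)} (hij : (i : ℕ) + 1 = j) :
    subdiagonalScale M N j = subdiagonalScale M N i * (N j i / M j i) := by
  rw [← hij, subdiagonalScale, Finset.prod_range_succ, ← entry_coe N j i, ← entry_coe M j i,
    subdiagonalScale, ← hij]
  push_cast
  rfl

/-- A tridiagonal-diagonal pair is determined up to isomorphism by its diagonals and the products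
of opposite off-diagonal entries. -/
theorem pairIsomorphic_of_products {b : Basis (Fin (d + 1)) K V} {A As : End K V}
    {N : Matrix (Fin (d + 1)) (Fin (d + 1)) K} {f : Fin (d + 1) → K}
    (hA : IsIrreducibleTridiagonal (LinearMap.toMatrix b b A)) (hN : IsIrreducibleTridiagonal N)
    (hAs : ∀ k, As (b k) = f k • b k) (hdiag : ∀ k, LinearMap.toMatrix b b A k k = N k k)
    (hoff : ∀ i j : Fin (d + 1), (i : ℕ) + 1 = j →
      LinearMap.toMatrix b b A i j * LinearMap.toMatrix b b A j i = N i j * N j i) :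
    PairIsomorphic A As (Matrix.toLin' N) (Matrix.toLin' (Matrix.diagonal f)) := by
  set M := LinearMap.toMatrix b b A with hM
  let c : Fin (d + 1) → K := fun k => subdiagonalScale M N k
  have hc : ∀ k, c k ≠ 0 := subdiagonalScale_ne_zero hA hN
  -- The diagonal matrix of `c` intertwines `M` and `N`: on the subdiagonal by the choice of `c`, on
  -- the superdiagonal because the products agree.
  have key : ∀ i j, M i j * c i = N i j * c j := by
    intro i j
    rcases lt_trichotomy (i : ℕ) j with h | h | h
    · rcases Nat.lt_or_ge ((i : ℕ) + 1) j with h' | h'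
      · rw [hA.1 i j (Or.inl h'), hN.1 i j (Or.inl h'), zero_mul, zero_mul]
      · have hij : (i : ℕ) + 1 = j := by omega
        have h0 := (hA.2 i j hij).2
        simp only [c]
        rw [subdiagonalScale_succ hij]
        field_simp
        linear_combination subdiagonalScale M N i * hoff i j hij
    · rw [show i = j from Fin.ext h, hdiag]
    · rcases Nat.lt_or_ge ((j : ℕ) + 1) i with h' | h'
      · rw [hA.1 i j (Or.inr h'), hN.1 i j (Or.inr h'), zero_mul, zero_mul]
      · have hij : (j : ℕ) + 1 = i := by omega
        have h0 := (hA.2 j i hij).2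
        simp only [c]
        rw [subdiagonalScale_succ hij]
        field_simp
  let b' : Basis (Fin (d + 1)) K (Fin (d + 1) → K) :=
    (Pi.basisFun K (Fin (d + 1))).isUnitSMul (fun k => (hc k).isUnit)
  have hb' : ∀ k, b' k = c k • Pi.basisFun K (Fin (d + 1)) k := fun k => Basis.isUnitSMul_apply _ k
  let σ : V ≃ₗ[K] (Fin (d + 1) → K) := b.equiv b' (Equiv.refl _)
  have hσ : ∀ k, σ (b k) = b' k := fun k => by simp [σ]
  refine pairIsomorphic_of_intertwining σ (b.ext fun j => ?_) (b.ext fun j => ?_)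
  · simp only [LinearMap.comp_apply, LinearEquiv.coe_coe]
    rw [← b.sum_repr (A (b j)), map_sum, hσ, hb', map_smul]
    ext i
    simp only [map_smul, hσ, hb', ← LinearMap.toMatrix_apply b b A]
    have h := key i j
    simp [Pi.single_apply, Finset.sum_apply, mul_comm]
    rw [← hM]
    linear_combination h
  · simp only [LinearMap.comp_apply, LinearEquiv.coe_coe]
    rw [hAs, map_smul, hσ, hb', map_smul, toLin'_diagonal_basisFun, smul_comm]

theorem isIrreducibleTridiagonal_rev {b : Basis (Fin (d + 1)) K V} {A : End K V}
    (hA : IsIrreducibleTridiagonal (LinearMap.toMatrix b b A)) :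
    IsIrreducibleTridiagonal
      (LinearMap.toMatrix (b.reindex Fin.revPerm) (b.reindex Fin.revPerm) A) := by
  have h : ∀ i j, LinearMap.toMatrix (b.reindex Fin.revPerm) (b.reindex Fin.revPerm) A i j =
      LinearMap.toMatrix b b A i.rev j.rev := fun i j => by
    simp [LinearMap.toMatrix_apply]
  refine ⟨fun i j hij => ?_, fun i j hij => ?_⟩
  · rw [h]
    exact hA.1 _ _ (by simp only [Fin.val_rev]; omega)
  · rw [h, h]
    exact (hA.2 j.rev i.rev (by simp only [Fin.val_rev]; omega)).symm

end Isomorphism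

/-! ### Scalar equations forced by the relations -/

section Scalars

open Module

variable {K V : Type*} [Field K] [AddCommGroup V] [Module K V] {d : ℕ}
  {b : Basis (Fin (d + 1)) K V} {A As : End K V} {θ : ℤ → K} {β ρ : K}

theorem theta_add_two (hA : IsIrreducibleTridiagonal (LinearMap.toMatrix b b A))
    (hAs : ∀ k : Fin (d + 1), As (b k) = θ (k : ℕ) • b k)
    (hAW : SatisfiesAW β 0 0 ρ ρ 0 0 0 A As) {j : ℕ} (hj : j + 2 ≤ d) :
    θ j + θ (j + 2) = β * θ (j + 1) := by
  have h := congrArg (fun f : End K V => b.coord ⟨j + 2, by omega⟩ (f (zext b j)))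
    (satisfiesAW_iff.mp hAW).1
  simp only [aw_left_apply (apply_zext hA.1) (apply_zext_of_apply_basis hAs), map_add, map_smul,
    coord_zext, LinearMap.zero_apply, map_zero, smul_eq_mul] at h
  rw [if_pos (by omega), if_neg (by omega), if_neg (by omega), if_neg (by omega),
    if_neg (by omega)] at h
  simp only [mul_zero, add_zero, mul_one] at h
  have e1 := entry_coe (LinearMap.toMatrix b b A) ⟨j + 1, by omega⟩ ⟨j, by omega⟩
  have e2 := entry_coe (LinearMap.toMatrix b b A) ⟨j + 2, by omega⟩ ⟨j + 1, by omega⟩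
  have n1 := (hA.2 ⟨j, by omega⟩ ⟨j + 1, by omega⟩ rfl).2
  have n2 := (hA.2 ⟨j + 1, by omega⟩ ⟨j + 2, by omega⟩ rfl).2
  push_cast at e1 e2
  rw [e1, show (j : ℤ) + 1 + 1 = j + 2 by ring, e2] at h
  exact sub_eq_zero.mp ((mul_eq_zero.mp h).resolve_left (mul_ne_zero n1 n2))

theorem theta_sq (hA : IsIrreducibleTridiagonal (LinearMap.toMatrix b b A))
    (hAs : ∀ k : Fin (d + 1), As (b k) = θ (k : ℕ) • b k)
    (hAW : SatisfiesAW β 0 0 ρ ρ 0 0 0 A As) {j : ℕ} (hj : j + 1 ≤ d) :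
    θ j ^ 2 - β * θ j * θ (j + 1) + θ (j + 1) ^ 2 = ρ := by
  have h := congrArg (fun f : End K V => b.coord ⟨j + 1, by omega⟩ (f (zext b j)))
    (satisfiesAW_iff.mp hAW).2
  simp only [aw_right_apply (apply_zext hA.1) (apply_zext_of_apply_basis hAs), map_add, map_smul,
    coord_zext, LinearMap.zero_apply, map_zero, smul_eq_mul] at h
  rw [if_pos (by omega), if_neg (by omega), if_neg (by omega)] at h
  simp only [mul_zero, add_zero, mul_one] at h
  have e1 := entry_coe (LinearMap.toMatrix b b A) ⟨j + 1, by omega⟩ ⟨j, by omega⟩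
  have n1 := (hA.2 ⟨j, by omega⟩ ⟨j + 1, by omega⟩ rfl).2
  push_cast at e1
  rw [e1] at h
  exact sub_eq_zero.mp ((mul_eq_zero.mp h).resolve_left n1)

theorem diag_mul_eq_zero (hA : IsIrreducibleTridiagonal (LinearMap.toMatrix b b A))
    (hAs : ∀ k : Fin (d + 1), As (b k) = θ (k : ℕ) • b k)
    (hAW : SatisfiesAW β 0 0 ρ ρ 0 0 0 A As) {j : ℕ} (hj : j ≤ d) :
    entry (LinearMap.toMatrix b b A) j j * ((2 - β) * θ j ^ 2 - ρ) = 0 := by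
  have h := congrArg (fun f : End K V => b.coord ⟨j, by omega⟩ (f (zext b j)))
    (satisfiesAW_iff.mp hAW).2
  simp only [aw_right_apply (apply_zext hA.1) (apply_zext_of_apply_basis hAs), map_add, map_smul,
    coord_zext, LinearMap.zero_apply, map_zero, smul_eq_mul] at h
  rw [if_neg (by omega), if_pos trivial, if_neg (by omega)] at h
  simpa only [mul_zero, add_zero, zero_add, mul_one] using h

theorem diagonal_eq_zero (hA : IsIrreducibleTridiagonal (LinearMap.toMatrix b b A))
    (hAs : ∀ k : Fin (d + 1), As (b k) = θ (k : ℕ) • b k)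
    (hAW : SatisfiesAW β 0 0 ρ ρ 0 0 0 A As)
    {M : Matrix (Fin (d + 1)) (Fin (d + 1)) K} (hM : LinearMap.toMatrix b b A = M)
    {j : ℕ} (hj : j ≤ d) :
    2 * θ j * (entry M (j - 1) j * entry M j (j - 1) + entry M j (j + 1) * entry M (j + 1) j +
        entry M j j ^ 2) - β * (entry M (j - 1) j * entry M j (j - 1) * θ (j - 1) +
        entry M j (j + 1) * entry M (j + 1) j * θ (j + 1) + entry M j j ^ 2 * θ j) -
        ρ * θ j = 0 := by
  subst hM
  have h := congrArg (fun f : End K V => b.coord ⟨j, by omega⟩ (f (zext b j)))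
    (satisfiesAW_iff.mp hAW).1
  simp only [aw_left_apply (apply_zext hA.1) (apply_zext_of_apply_basis hAs), map_add, map_smul,
    coord_zext, LinearMap.zero_apply, map_zero, smul_eq_mul] at h
  rw [if_neg (by omega), if_neg (by omega), if_pos trivial, if_neg (by omega), if_neg (by omega)] at h
  simpa only [mul_zero, add_zero, zero_add, mul_one, sub_add_cancel, add_sub_cancel_right] using h

end Scalars

/-! ### Classification -/

section Classification

open Module

variable {K V : Type*} [Field K] [AddCommGroup V] [Module K V] {d : ℕ} {q r u : K}
  {b : Basis (Fin (d + 1)) K V} {A As : End K V}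

theorem sq_sub_inv_ne_zero (hq0 : q ≠ 0) (hq : ∀ n : ℕ, 0 < n → q ^ n ≠ 1) :
    q ^ 2 - (q ^ 2)⁻¹ ≠ 0 :=
  sub_inv_ne_zero (pow_ne_zero 2 hq0) (by rw [← pow_mul]; exact hq _ (by omega))

theorem two_sub_beta_ne_zero (hq0 : q ≠ 0) (hq : ∀ n : ℕ, 0 < n → q ^ n ≠ 1) :
    2 - (q ^ 2 + (q ^ 2)⁻¹) ≠ 0 := by
  rw [show 2 - (q ^ 2 + (q ^ 2)⁻¹) = -(q - q⁻¹) ^ 2 by field_simp; ring]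
  exact neg_ne_zero.mpr (pow_ne_zero 2 (sub_inv_self_ne_zero hq0 hq))

/-- The common factor 2 - β cancels from (2 - β) θ_j² = (2 - β)(2 + β), and 2 + β = (q + q⁻¹)². -/
theorem theta_sq_of_diag_ne_zero (hq0 : q ≠ 0) (hq : ∀ n : ℕ, 0 < n → q ^ n ≠ 1) {θ : ℤ → K}
    (hA : IsIrreducibleTridiagonal (LinearMap.toMatrix b b A))
    (hAs : ∀ k : Fin (d + 1), As (b k) = θ (k : ℕ) • b k)
    (hAW : SatisfiesAW (q ^ 2 + (q ^ 2)⁻¹) 0 0 (4 - (q ^ 2 + (q ^ 2)⁻¹) ^ 2)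
      (4 - (q ^ 2 + (q ^ 2)⁻¹) ^ 2) 0 0 0 A As) {j : ℕ} (hj : j ≤ d)
    (ha : entry (LinearMap.toMatrix b b A) j j ≠ 0) : θ j ^ 2 = (q + q⁻¹) ^ 2 := by
  have h := (mul_eq_zero.mp (diag_mul_eq_zero hA hAs hAW hj)).resolve_left ha
  refine mul_left_cancel₀ (two_sub_beta_ne_zero hq0 hq) ?_
  rw [show (q + q⁻¹) ^ 2 = 2 + (q ^ 2 + (q ^ 2)⁻¹) by field_simp; ring]
  linear_combination h

theorem term_sq_of_diag_ne_zero (hu : u ≠ 0) (hq0 : q ≠ 0) (hq : ∀ n : ℕ, 0 < n → q ^ n ≠ 1)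
    (hA : IsIrreducibleTridiagonal (LinearMap.toMatrix b b A))
    (hAs : ∀ k : Fin (d + 1), As (b k) = stringSum u q (k : ℕ) • b k)
    (hAW : SatisfiesAW (q ^ 2 + (q ^ 2)⁻¹) 0 0 (4 - (q ^ 2 + (q ^ 2)⁻¹) ^ 2)
      (4 - (q ^ 2 + (q ^ 2)⁻¹) ^ 2) 0 0 0 A As) {j : ℕ} (hj : j ≤ d)
    (ha : entry (LinearMap.toMatrix b b A) j j ≠ 0) :
    (u * q ^ (2 * (j : ℤ))) ^ 2 = q ^ 2 ∨ (u * q ^ (2 * (j : ℤ))) ^ 2 * q ^ 2 = 1 := by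
  have h := theta_sq_of_diag_ne_zero hq0 hq hA hAs hAW hj ha
  have ht : u * q ^ (2 * (j : ℤ)) ≠ 0 := mul_ne_zero hu (zpow_ne_zero _ hq0)
  rw [stringSum] at h
  generalize u * q ^ (2 * (j : ℤ)) = t at *
  refine add_inv_eq_add_inv (pow_ne_zero 2 ht) (pow_ne_zero 2 hq0) ?_
  have e : ∀ x : K, x ≠ 0 → x ^ 2 + (x ^ 2)⁻¹ = (x + x⁻¹) ^ 2 - 2 := by
    intro x hx
    field_simp
    ring
  rw [e t ht, e q hq0, h]

theorem telescope (hu : u ≠ 0) (hq0 : q ≠ 0)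
    (hA : IsIrreducibleTridiagonal (LinearMap.toMatrix b b A))
    (hAs : ∀ k : Fin (d + 1), As (b k) = stringSum u q (k : ℕ) • b k)
    (hAW : SatisfiesAW (q ^ 2 + (q ^ 2)⁻¹) 0 0 (4 - (q ^ 2 + (q ^ 2)⁻¹) ^ 2)
      (4 - (q ^ 2 + (q ^ 2)⁻¹) ^ 2) 0 0 0 A As)
    {M : Matrix (Fin (d + 1)) (Fin (d + 1)) K} (hM : LinearMap.toMatrix b b A = M)
    {j : ℕ} (hj : j ≤ d) :
    (q ^ 2 - (q ^ 2)⁻¹) * (entry M (j - 1) j * entry M j (j - 1) *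
        (stringDiff u q j * stringDiff u q (j - 1)) -
      entry M j (j + 1) * entry M (j + 1) j * (stringDiff u q (j + 1) * stringDiff u q j) +
        (stringGap u q (j + 1) - stringGap u q j)) +
      (2 - (q ^ 2 + (q ^ 2)⁻¹)) * entry M j j ^ 2 * (stringSum u q j * stringDiff u q j) = 0 := by
  rw [← stringDiff_mul_diagonal hu hq0, diagonal_eq_zero hA hAs hAW hM hj, mul_zero]

/-- The sum starts at row 0, where the product with the missing neighbour is zero. The range extends
to j = d + 1, where the left side is again zero; this gives the condition on `u`. -/
theorem products_of_diag_eq_zero (hu : u ≠ 0) (hq0 : q ≠ 0) (hq : ∀ n : ℕ, 0 < n → q ^ n ≠ 1)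
    (hA : IsIrreducibleTridiagonal (LinearMap.toMatrix b b A))
    (hAs : ∀ k : Fin (d + 1), As (b k) = stringSum u q (k : ℕ) • b k)
    (hAW : SatisfiesAW (q ^ 2 + (q ^ 2)⁻¹) 0 0 (4 - (q ^ 2 + (q ^ 2)⁻¹) ^ 2)
      (4 - (q ^ 2 + (q ^ 2)⁻¹) ^ 2) 0 0 0 A As)
    {M : Matrix (Fin (d + 1)) (Fin (d + 1)) K} (hM : LinearMap.toMatrix b b A = M)
    (ha : ∀ j : ℕ, j ≤ d → entry M j j = 0) {j : ℕ} (hj : j ≤ d + 1) :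
    entry M (j - 1) j * entry M j (j - 1) * (stringDiff u q j * stringDiff u q (j - 1)) =
      stringGap u q j - stringGap u q 0 := by
  induction j with
  | zero =>
    rw [entry_of_row_neg _ _ (by omega), Nat.cast_zero]
    ring
  | succ j ih =>
    have h := telescope hu hq0 hA hAs hAW hM (j := j) (by omega)
    rw [ha j (by omega), ih (by omega), zero_pow two_ne_zero, mul_zero, zero_mul, add_zero] at h
    have h' := (mul_eq_zero.mp h).resolve_left (sq_sub_inv_ne_zero hq0 hq)
    push_cast
    rw [add_sub_cancel_right]
    linear_combination -h'

theorem products_of_diag_eq_zero_of_pos (hu : u ≠ 0) (hq0 : q ≠ 0)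
    (hq : ∀ n : ℕ, 0 < n → q ^ n ≠ 1)
    (hA : IsIrreducibleTridiagonal (LinearMap.toMatrix b b A))
    (hAs : ∀ k : Fin (d + 1), As (b k) = stringSum u q (k : ℕ) • b k)
    (hAW : SatisfiesAW (q ^ 2 + (q ^ 2)⁻¹) 0 0 (4 - (q ^ 2 + (q ^ 2)⁻¹) ^ 2)
      (4 - (q ^ 2 + (q ^ 2)⁻¹) ^ 2) 0 0 0 A As)
    {M : Matrix (Fin (d + 1)) (Fin (d + 1)) K} (hM : LinearMap.toMatrix b b A = M)
    (ha : ∀ j : ℕ, 0 < j → j ≤ d → entry M j j = 0) {j : ℕ} (hj : j ≤ d) :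
    entry M j (j + 1) * entry M (j + 1) j * (stringDiff u q (j + 1) * stringDiff u q j) =
      stringGap u q (j + 1) - stringGap u q (d + 1) := by
  have const : ∀ n : ℕ, n ≤ d →
      entry M n (n + 1) * entry M (n + 1) n * (stringDiff u q (n + 1) * stringDiff u q n) -
        stringGap u q (n + 1) =
      entry M 0 1 * entry M 1 0 * (stringDiff u q 1 * stringDiff u q 0) - stringGap u q 1 := by
    intro n
    induction n with
    | zero => simp
    | succ n ih =>
      intro hn
      have h := telescope hu hq0 hA hAs hAW hM hn
      rw [ha _ (by omega) hn, zero_pow two_ne_zero, mul_zero, zero_mul, add_zero] at h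
      have h' := (mul_eq_zero.mp h).resolve_left (sq_sub_inv_ne_zero hq0 hq)
      rw [← ih (by omega)]
      push_cast at h' ⊢
      rw [add_sub_cancel_right] at h'
      linear_combination -h'
  have h1 := const j hj
  have h2 := const d le_rfl
  rw [entry_of_col_ge _ (d : ℤ) (by push_cast; omega)] at h2
  linear_combination h1 - h2

theorem pairIsomorphic_matA₁ (h2 : (2 : K) ≠ 0) (hq0 : q ≠ 0) (hq : ∀ n : ℕ, 0 < n → q ^ n ≠ 1)
    (hr : r ^ 2 = -1) (hA : IsIrreducibleTridiagonal (LinearMap.toMatrix b b A))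
    (hAs : ∀ k : Fin (d + 1), As (b k) = stringSum (-r * q ^ (-(d : ℤ))) q (k : ℕ) • b k)
    (hAW : SatisfiesAW (q ^ 2 + (q ^ 2)⁻¹) 0 0 (4 - (q ^ 2 + (q ^ 2)⁻¹) ^ 2)
      (4 - (q ^ 2 + (q ^ 2)⁻¹) ^ 2) 0 0 0 A As) :
    PairIsomorphic A As (Matrix.toLin' (matA₁ d q r)) (Matrix.toLin' (matA₁s d q r)) := by
  have hu := string₁_ne_zero (d := d) hq0 hr
  -- Here t_j² = -q^{2(2j-d)}, so t_j² = q^{±2} would make a power of q equal to -1.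
  have ha : ∀ j : ℕ, j ≤ d → entry (LinearMap.toMatrix b b A) j j = 0 := by
    intro j hj
    by_contra ha
    have h := term_sq_of_diag_ne_zero hu hq0 hq hA hAs hAW hj ha
    rw [string₁_term hq0, mul_pow, neg_sq, hr] at h
    rcases h with h | h
    · refine zpow_ne_neg_one h2 hq (2 * (2 * j - d) - 2) ?_
      rw [zpow_sub₀ hq0, div_eq_iff (zpow_ne_zero _ hq0), zpow_mul']
      simp only [zpow_ofNat]
      linear_combination -h
    · refine zpow_ne_neg_one h2 hq (2 * (2 * j - d) + 2) ?_
      rw [zpow_add₀ hq0, zpow_mul']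
      simp only [zpow_ofNat]
      linear_combination -h
  rw [matA₁s_eq hq0 hr]
  refine pairIsomorphic_of_products hA (matA₁_irreducible h2 hq0 hq hr) hAs ?_ ?_
  · intro k
    rw [← entry_coe (LinearMap.toMatrix b b A), ha _ (by omega), ← entry_coe (matA₁ d q r),
      entry_matA₁_diag]
  · intro i j hij
    have e1 := products_of_diag_eq_zero hu hq0 hq hA hAs hAW rfl ha (j := j) (by omega)
    have e2 := matA₁_mul (d := d) h2 hq0 hq hr (j := (j : ℕ)) (by omega) (by omega)
    have hne := stringDiff₁_ne_zero (d := d) h2 hq0 hq hr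
    rw [show ((j : ℕ) : ℤ) - 1 = (i : ℕ) by omega] at e1 e2
    rw [← entry_coe (LinearMap.toMatrix b b A) i j, ← entry_coe (LinearMap.toMatrix b b A) j i,
      ← entry_coe (matA₁ d q r) i j, ← entry_coe (matA₁ d q r) j i]
    exact mul_right_cancel₀ (mul_ne_zero (hne _) (hne _)) (e1.trans e2.symm)

theorem diag_eq_zero₂ (hq0 : q ≠ 0) (hq : ∀ n : ℕ, 0 < n → q ^ n ≠ 1)
    (hA : IsIrreducibleTridiagonal (LinearMap.toMatrix b b A))
    (hAs : ∀ k : Fin (d + 1), As (b k) = stringSum q q (k : ℕ) • b k)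
    (hAW : SatisfiesAW (q ^ 2 + (q ^ 2)⁻¹) 0 0 (4 - (q ^ 2 + (q ^ 2)⁻¹) ^ 2)
      (4 - (q ^ 2 + (q ^ 2)⁻¹) ^ 2) 0 0 0 A As) {j : ℕ} (h0 : 0 < j) (hj : j ≤ d) :
    entry (LinearMap.toMatrix b b A) j j = 0 := by
  by_contra ha
  have h := term_sq_of_diag_ne_zero hq0 hq0 hq hA hAs hAW hj ha
  rw [string₂_term hq0, ← zpow_natCast, ← zpow_mul, ← zpow_natCast q 2] at h
  rcases h with h | h
  · have := zpow_inj_of_pow_ne_one hq0 hq h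
    push_cast at this
    omega
  · rw [← zpow_add₀ hq0] at h
    exact zpow_ne_one_of_pow_ne_one hq (by push_cast; omega) h

/-- The products are known from the last row upwards, so row 0 of the telescoped relation fixes the
square of the corner entry. -/
theorem corner_eq_or_eq_neg (hq0 : q ≠ 0) (hq : ∀ n : ℕ, 0 < n → q ^ n ≠ 1)
    (hA : IsIrreducibleTridiagonal (LinearMap.toMatrix b b A))
    (hAs : ∀ k : Fin (d + 1), As (b k) = stringSum q q (k : ℕ) • b k)
    (hAW : SatisfiesAW (q ^ 2 + (q ^ 2)⁻¹) 0 0 (4 - (q ^ 2 + (q ^ 2)⁻¹) ^ 2)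
      (4 - (q ^ 2 + (q ^ 2)⁻¹) ^ 2) 0 0 0 A As) :
    entry (LinearMap.toMatrix b b A) 0 0 = entry (matA₂ d q) 0 0 ∨
      entry (LinearMap.toMatrix b b A) 0 0 = -entry (matA₂ d q) 0 0 := by
  have e1 := products_of_diag_eq_zero_of_pos hq0 hq0 hq hA hAs hAW rfl
    (fun j => diag_eq_zero₂ hq0 hq hA hAs hAW) (Nat.zero_le d)
  have e2 := telescope hq0 hq0 hA hAs hAW rfl (Nat.zero_le d)
  rw [e1, entry_of_row_neg _ _ (by norm_num), Nat.cast_zero,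
    stringSum_mul_stringDiff₂_zero hq0] at e2
  have e3 := corner_sq (d := d) hq0 hq
  refine sq_eq_sq_iff_eq_or_eq_neg.mp ?_
  refine mul_left_cancel₀ (mul_ne_zero (two_sub_beta_ne_zero hq0 hq)
    (sq_sub_inv_ne_zero hq0 hq)) ?_
  linear_combination e2 + (q ^ 2 - (q ^ 2)⁻¹) * e3

theorem pairIsomorphic_matA₂ (hq0 : q ≠ 0) (hq : ∀ n : ℕ, 0 < n → q ^ n ≠ 1)
    (hA : IsIrreducibleTridiagonal (LinearMap.toMatrix b b A))
    (hAs : ∀ k : Fin (d + 1), As (b k) = stringSum q q (k : ℕ) • b k)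
    (hAW : SatisfiesAW (q ^ 2 + (q ^ 2)⁻¹) 0 0 (4 - (q ^ 2 + (q ^ 2)⁻¹) ^ 2)
      (4 - (q ^ 2 + (q ^ 2)⁻¹) ^ 2) 0 0 0 A As)
    (h0 : entry (LinearMap.toMatrix b b A) 0 0 = entry (matA₂ d q) 0 0) :
    PairIsomorphic A As (Matrix.toLin' (matA₂ d q)) (Matrix.toLin' (matA₂s d q)) := by
  rw [matA₂s_eq hq0]
  refine pairIsomorphic_of_products hA (matA₂_irreducible hq0 hq) hAs ?_ ?_
  · intro k
    rw [← entry_coe (LinearMap.toMatrix b b A), ← entry_coe (matA₂ d q)]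
    rcases Nat.eq_zero_or_pos (k : ℕ) with hk | hk
    · rw [hk]
      exact h0
    · rw [diag_eq_zero₂ hq0 hq hA hAs hAW hk (by omega), entry_matA₂_diag (by omega)]
  · intro i j hij
    have e1 := products_of_diag_eq_zero_of_pos hq0 hq0 hq hA hAs hAW rfl
      (fun j => diag_eq_zero₂ hq0 hq hA hAs hAW) (j := i) (by omega)
    have e2 := matA₂_mul (d := d) hq0 hq (j := (j : ℕ)) (by omega) (by omega)
    have hne := stringDiff₂_ne_zero hq0 hq
    rw [show ((i : ℕ) : ℤ) + 1 = (j : ℕ) by omega] at e1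
    rw [show ((j : ℕ) : ℤ) - 1 = (i : ℕ) by omega] at e2
    rw [← entry_coe (LinearMap.toMatrix b b A) i j, ← entry_coe (LinearMap.toMatrix b b A) j i,
      ← entry_coe (matA₂ d q) i j, ← entry_coe (matA₂ d q) j i]
    exact mul_right_cancel₀ (mul_ne_zero (hne _) (hne _)) (e1.trans e2.symm)

theorem pairIsomorphic_matA₂_or_neg (hq0 : q ≠ 0) (hq : ∀ n : ℕ, 0 < n → q ^ n ≠ 1)
    (hA : IsIrreducibleTridiagonal (LinearMap.toMatrix b b A))
    (hAs : ∀ k : Fin (d + 1), As (b k) = stringSum q q (k : ℕ) • b k)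
    (hAW : SatisfiesAW (q ^ 2 + (q ^ 2)⁻¹) 0 0 (4 - (q ^ 2 + (q ^ 2)⁻¹) ^ 2)
      (4 - (q ^ 2 + (q ^ 2)⁻¹) ^ 2) 0 0 0 A As) :
    PairIsomorphic A As (Matrix.toLin' (matA₂ d q)) (Matrix.toLin' (matA₂s d q)) ∨
      PairIsomorphic A As (Matrix.toLin' (-matA₂ d q)) (Matrix.toLin' (matA₂s d q)) := by
  rcases corner_eq_or_eq_neg hq0 hq hA hAs hAW with h | h
  · exact Or.inl (pairIsomorphic_matA₂ hq0 hq hA hAs hAW h)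
  · right
    have hneg : LinearMap.toMatrix b b (-A) = -LinearMap.toMatrix b b A := map_neg _ _
    have h' := (pairIsomorphic_matA₂ hq0 hq (b := b) (A := -A) (by rw [hneg]; exact hA.neg) hAs
      hAW.neg_left ?_).neg_left
    · rwa [neg_neg, ← map_neg] at h'
    · rw [hneg, eq_comm, ← neg_eq_iff_eq_neg.mpr h]
      have e1 := entry_coe (LinearMap.toMatrix b b A) 0 0
      have e2 := entry_coe (-LinearMap.toMatrix b b A) 0 0
      simp only [Fin.val_zero, Nat.cast_zero] at e1 e2
      rw [e1, e2, Matrix.neg_apply]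

/-- The normal forms of the eigenvalue sequence. -/
def IsNormalString (d : ℕ) (q r : K) (As : End K V) (b : Basis (Fin (d + 1)) K V) : Prop :=
  (∀ k : Fin (d + 1), As (b k) = stringSum (-r * q ^ (-(d : ℤ))) q (k : ℕ) • b k) ∨
  (∀ k : Fin (d + 1), As (b k) = stringSum q q (k : ℕ) • b k) ∨
  (∀ k : Fin (d + 1), As (b k) = (-stringSum q q (k : ℕ)) • b k)

theorem exists_fivePairs_of_isNormalString (h2 : (2 : K) ≠ 0) (hq0 : q ≠ 0)
    (hq : ∀ n : ℕ, 0 < n → q ^ n ≠ 1) (hr : r ^ 2 = -1)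
    (hA : IsIrreducibleTridiagonal (LinearMap.toMatrix b b A))
    (hAs : IsNormalString d q r As b)
    (hAW : SatisfiesAW (q ^ 2 + (q ^ 2)⁻¹) 0 0 (4 - (q ^ 2 + (q ^ 2)⁻¹) ^ 2)
      (4 - (q ^ 2 + (q ^ 2)⁻¹) ^ 2) 0 0 0 A As) :
    ∃ k : Fin 5, PairIsomorphic A As
      (Matrix.toLin' (fivePairs d q r k).1) (Matrix.toLin' (fivePairs d q r k).2) := by
  rcases hAs with hAs | hAs | hAs
  · exact ⟨0, pairIsomorphic_matA₁ h2 hq0 hq hr hA hAs hAW⟩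
  · rcases pairIsomorphic_matA₂_or_neg hq0 hq hA hAs hAW with h | h
    · exact ⟨1, h⟩
    · exact ⟨3, h⟩
  · have hAs' : ∀ k : Fin (d + 1), (-As) (b k) = stringSum q q (k : ℕ) • b k := fun k => by
      rw [LinearMap.neg_apply, hAs, neg_smul, neg_neg]
    rcases pairIsomorphic_matA₂_or_neg hq0 hq hA hAs' hAW.neg_right with h | h <;>
      have h := h.neg_right <;> rw [neg_neg, ← map_neg] at h
    · exact ⟨2, h⟩
    · exact ⟨4, h⟩

theorem stringSum_rev (hq0 : q ≠ 0) (k : Fin (d + 1)) :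
    stringSum u q (k.rev : ℕ) = stringSum (u * q ^ (2 * (d : ℤ)))⁻¹ q (k : ℕ) := by
  have h : u * q ^ (2 * ((k.rev : ℕ) : ℤ)) =
      ((u * q ^ (2 * (d : ℤ)))⁻¹ * q ^ (2 * ((k : ℕ) : ℤ)))⁻¹ := by
    rw [mul_inv, inv_inv, ← zpow_neg, mul_assoc, ← zpow_add₀ hq0]
    congr 2
    rw [Fin.val_rev]
    omega
  rw [stringSum, stringSum, h, inv_inv, add_comm]

theorem stringSum_neg (u q : K) (j : ℤ) : stringSum (-u) q j = -stringSum u q j := by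
  rw [stringSum, stringSum, neg_mul, inv_neg]
  ring

/-- If `A` has zero diagonal, the boundary conditions at both ends force u⁴ q^{4d} = 1. Otherwise
distinctness of the eigenvalues pushes a nonzero diagonal entry to an end of the basis, which
reversal moves to index 0. -/
theorem exists_isNormalString_of_string (hq0 : q ≠ 0) (hq : ∀ n : ℕ, 0 < n → q ^ n ≠ 1)
    (hr : r ^ 2 = -1) (hd : 0 < d) (hu : u ≠ 0)
    (hA : IsIrreducibleTridiagonal (LinearMap.toMatrix b b A))
    (hAs : ∀ k : Fin (d + 1), As (b k) = stringSum u q (k : ℕ) • b k)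
    (hinj : Function.Injective fun k : Fin (d + 1) => stringSum u q (k : ℕ))
    (hAW : SatisfiesAW (q ^ 2 + (q ^ 2)⁻¹) 0 0 (4 - (q ^ 2 + (q ^ 2)⁻¹) ^ 2)
      (4 - (q ^ 2 + (q ^ 2)⁻¹) ^ 2) 0 0 0 A As) :
    ∃ b' : Basis (Fin (d + 1)) K V, IsIrreducibleTridiagonal (LinearMap.toMatrix b' b' A) ∧
      IsNormalString d q r As b' := by
  have hAsrev : ∀ k : Fin (d + 1), As (b.reindex Fin.revPerm k) =
      stringSum (u * q ^ (2 * (d : ℤ)))⁻¹ q (k : ℕ) • b.reindex Fin.revPerm k := by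
    intro k
    rw [← stringSum_rev hq0]
    simpa using hAs k.rev
  have hinj' : ∀ i j : ℕ, i ≤ d → j ≤ d → i ≠ j → stringSum u q i ≠ stringSum u q j := by
    intro i j hi hj hij h
    have := @hinj ⟨i, by omega⟩ ⟨j, by omega⟩ h
    exact hij (by simpa using this)
  by_cases ha : ∀ j : ℕ, j ≤ d → entry (LinearMap.toMatrix b b A) j j = 0
  · have h := products_of_diag_eq_zero hu hq0 hq hA hAs hAW rfl ha le_rfl
    rw [entry_of_col_ge _ _ (by omega), zero_mul, zero_mul, eq_comm] at h
    have hD : q ^ (d : ℤ) ≠ 0 := zpow_ne_zero _ hq0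
    have hfac : (q ^ (2 * (d : ℤ) + 2) - q ^ (-2 * (d : ℤ) - 2)) *
        ((u ^ 2 * q ^ (2 * (d : ℤ)) - 1) * (u ^ 2 * q ^ (2 * (d : ℤ)) + 1)) = 0 := by
      have hcalc : (q ^ (2 * (d : ℤ) + 2) - q ^ (-2 * (d : ℤ) - 2)) *
        ((u ^ 2 * q ^ (2 * (d : ℤ)) - 1) * (u ^ 2 * q ^ (2 * (d : ℤ)) + 1)) =
          u ^ 2 * q ^ (2 * (d : ℤ)) * (stringGap u q ((d + 1 : ℕ) : ℤ) - stringGap u q 0) := by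
        simp only [stringGap]
        push_cast
        simp only [mul_add, neg_mul, zpow_neg, zpow_sub₀ hq0, zpow_add₀ hq0, zpow_mul',
          zpow_ofNat, mul_one]
        generalize q ^ (d : ℤ) = D at *
        field_simp
        ring
      rw [hcalc, h, mul_zero]
    have hfac' := (mul_eq_zero.mp hfac).resolve_left
      (zpow_sub_zpow_ne_zero hq0 hq (by omega))
    rcases mul_eq_zero.mp hfac' with h1 | h1
    -- u² q^{2d} = 1 says that u q^{2d} = u⁻¹, so the two extreme eigenvalues coincide although d >
    -- 0.
    · exfalso
      refine hinj' 0 d (by omega) le_rfl (by omega) ?_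
      have e : u * q ^ (2 * (d : ℤ)) = u⁻¹ := eq_inv_of_mul_eq_one_left (by linear_combination h1)
      rw [stringSum, stringSum, e, Nat.cast_zero, mul_zero, zpow_zero, mul_one, inv_inv, add_comm]
    · have h3 : (u * q ^ (d : ℤ)) ^ 2 = r ^ 2 := by
        rw [hr, mul_pow]
        rw [zpow_mul', zpow_ofNat] at h1
        linear_combination h1
      -- The two square roots of -1 correspond to the string and its reversal.
      rcases sq_eq_sq_iff_eq_or_eq_neg.mp h3 with h4 | h4
      · refine ⟨b.reindex Fin.revPerm, isIrreducibleTridiagonal_rev hA, Or.inl ?_⟩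
        have e : (u * q ^ (2 * (d : ℤ)))⁻¹ = -r * q ^ (-(d : ℤ)) := by
          rw [two_mul, zpow_add₀ hq0, ← mul_assoc, h4, mul_inv, inv_eq_neg_of_sq hr, zpow_neg]
        rwa [e] at hAsrev
      · refine ⟨b, hA, Or.inl ?_⟩
        have e : u = -r * q ^ (-(d : ℤ)) := by
          rw [← h4, zpow_neg, mul_inv_cancel_right₀ hD]
        rwa [← e]
  · push Not at ha
    obtain ⟨j, hj, ha⟩ := ha
    have ht : u * q ^ (2 * (j : ℤ)) ≠ 0 := mul_ne_zero hu (zpow_ne_zero _ hq0)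
    have hsign : ∀ (c : Basis (Fin (d + 1)) K V) (w : K), (w = q ∨ w = -q) →
        (∀ k : Fin (d + 1), As (c k) = stringSum w q (k : ℕ) • c k) → IsNormalString d q r As c := by
      rintro c w (rfl | rfl) h
      · exact Or.inr (Or.inl h)
      · right; right
        intro k
        rw [h, stringSum_neg]
    rcases term_sq_of_diag_ne_zero hu hq0 hq hA hAs hAW hj ha with h | h
    -- t_j² = q² gives t_{j-1} = t_j⁻¹, hence θ_{j-1} = θ_j.
    · have hj0 : j = 0 := by
        by_contra hj0
        refine hinj' (j - 1) j (by omega) hj (by omega) ?_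
        rw [Nat.cast_sub (by omega), stringSum, stringSum, Nat.cast_one,
          mul_zpow_two_mul_sub_one hq0, ← h]
        generalize u * q ^ (2 * (j : ℤ)) = t at *
        field_simp
        ring
      subst hj0
      refine ⟨b, hA, hsign b u ?_ hAs⟩
      rw [Nat.cast_zero, mul_zero, zpow_zero, mul_one] at h
      exact sq_eq_sq_iff_eq_or_eq_neg.mp h
    -- t_j² q² = 1 gives t_{j+1} = t_j⁻¹, hence θ_{j+1} = θ_j.
    · have hjd : j = d := by
        by_contra hjd
        refine hinj' (j + 1) j (by omega) hj (by omega) ?_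
        rw [stringSum, stringSum]
        push_cast
        rw [mul_zpow_two_mul_add_one hq0]
        generalize u * q ^ (2 * (j : ℤ)) = t at *
        have e : q ^ 2 = (t ^ 2)⁻¹ := eq_inv_of_mul_eq_one_left (by linear_combination h)
        rw [e]
        field_simp
        ring
      subst hjd
      refine ⟨b.reindex Fin.revPerm, isIrreducibleTridiagonal_rev hA, hsign _ _ ?_ hAsrev⟩
      refine sq_eq_sq_iff_eq_or_eq_neg.mp ?_
      rw [inv_pow]
      exact inv_eq_of_mul_eq_one_right h

theorem exists_string (hq0 : q ≠ 0) (hq : ∀ n : ℕ, 0 < n → q ^ n ≠ 1) (hd : 0 < d) {θ : ℤ → K}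
    (hA : IsIrreducibleTridiagonal (LinearMap.toMatrix b b A))
    (hAs : ∀ k : Fin (d + 1), As (b k) = θ (k : ℕ) • b k)
    (hAW : SatisfiesAW (q ^ 2 + (q ^ 2)⁻¹) 0 0 (4 - (q ^ 2 + (q ^ 2)⁻¹) ^ 2)
      (4 - (q ^ 2 + (q ^ 2)⁻¹) ^ 2) 0 0 0 A As) :
    ∃ u : K, u ≠ 0 ∧ ∀ j : ℕ, j ≤ d → θ j = stringSum u q j := by
  have hs := sq_sub_inv_ne_zero hq0 hq
  -- Initial values of the general solution of the linear recurrence; the quadratic relation then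
  -- reads u v ρ = ρ with ρ = -(q² - q⁻²)² ≠ 0, so u v = 1.
  obtain ⟨u, v, h0, h1⟩ : ∃ u v : K, θ 0 = u + v ∧ θ 1 = u * q ^ 2 + v * (q ^ 2)⁻¹ := by
    refine ⟨(θ 1 - (q ^ 2)⁻¹ * θ 0) / (q ^ 2 - (q ^ 2)⁻¹),
      (q ^ 2 * θ 0 - θ 1) / (q ^ 2 - (q ^ 2)⁻¹), ?_, ?_⟩
    · rw [← add_div, eq_div_iff hs]
      ring
    · rw [div_mul_eq_mul_div, div_mul_eq_mul_div, ← add_div, eq_div_iff hs]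
      ring
  have huv : u * v = 1 := by
    have h := theta_sq hA hAs hAW (j := 0) (by omega)
    simp only [Nat.cast_zero, zero_add, h0, h1] at h
    refine mul_left_cancel₀ (pow_ne_zero 2 hs) ?_
    field_simp at h ⊢
    linear_combination -h
  have hu : u ≠ 0 := left_ne_zero_of_mul_eq_one huv
  have hv : v = u⁻¹ := (inv_eq_of_mul_eq_one_right huv).symm
  subst hv
  refine ⟨u, hu, fun j => ?_⟩
  induction j using Nat.twoStepInduction with
  | zero =>
    intro _
    simp [stringSum, h0]
  | one =>
    intro _
    rw [Nat.cast_one, h1, stringSum, mul_one, mul_inv]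
    norm_cast
  | more n ih1 ih2 =>
    intro hn
    have e1 := theta_add_two hA hAs hAW hn
    have e2 := stringSum_add_two hu hq0 n
    have e3 := ih2 (by omega)
    push_cast at e3 ⊢
    rw [ih1 (by omega), e3] at e1
    linear_combination e1 - e2

/-- In dimension one only the diagonal equations remain: either `A` is zero and ρ θ_0 = 0, or θ_0 =
±(q + q⁻¹). -/
theorem exists_isNormalString_of_eq_zero (hq0 : q ≠ 0) (hq : ∀ n : ℕ, 0 < n → q ^ n ≠ 1)
    (hr : r ^ 2 = -1) (hd : d = 0) {θ : ℤ → K}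
    (hA : IsIrreducibleTridiagonal (LinearMap.toMatrix b b A))
    (hAs : ∀ k : Fin (d + 1), As (b k) = θ (k : ℕ) • b k)
    (hAW : SatisfiesAW (q ^ 2 + (q ^ 2)⁻¹) 0 0 (4 - (q ^ 2 + (q ^ 2)⁻¹) ^ 2)
      (4 - (q ^ 2 + (q ^ 2)⁻¹) ^ 2) 0 0 0 A As) :
    IsNormalString d q r As b := by
  subst hd
  have hk : ∀ k : Fin (0 + 1), (((k : ℕ) : ℤ)) = 0 := fun k => by omega
  by_cases ha : entry (LinearMap.toMatrix b b A) ((0 : ℕ) : ℤ) ((0 : ℕ) : ℤ) = 0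
  · left
    have h := diagonal_eq_zero hA hAs hAW rfl le_rfl
    rw [ha, entry_of_row_neg _ _ (by norm_num),
      entry_of_row_ge _ (i := ((0 : ℕ) : ℤ) + 1) _ (by norm_num)] at h
    have hρ : 4 - (q ^ 2 + (q ^ 2)⁻¹) ^ 2 ≠ 0 := by
      rw [show 4 - (q ^ 2 + (q ^ 2)⁻¹) ^ 2 = -(q ^ 2 - (q ^ 2)⁻¹) ^ 2 by field_simp; ring]
      exact neg_ne_zero.mpr (pow_ne_zero 2 (sq_sub_inv_ne_zero hq0 hq))
    have hθ : θ 0 = 0 := by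
      refine (mul_eq_zero.mp (?_ : (4 - (q ^ 2 + (q ^ 2)⁻¹) ^ 2) * θ 0 = 0)).resolve_left hρ
      simp only [Nat.cast_zero] at h
      linear_combination -h
    intro k
    rw [hAs, hk, hθ, stringSum₁ hq0 hr]
    simp
  · right
    have h := theta_sq_of_diag_ne_zero hq0 hq hA hAs hAW le_rfl ha
    rw [Nat.cast_zero] at h
    have hs : stringSum q q 0 = q + q⁻¹ := by simp [stringSum]
    rcases sq_eq_sq_iff_eq_or_eq_neg.mp h with h | h
    · left
      intro k
      rw [hAs, hk, h, hs]
    · right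
      intro k
      rw [hAs, hk, h, hs]

/-- The classification of Leonard pairs satisfying the given Askey-Wilson relations. -/
theorem exists_fivePairs (h2 : (2 : K) ≠ 0) (hq0 : q ≠ 0)
    (hq : ∀ n : ℕ, 0 < n → q ^ n ≠ 1) (hr : r ^ 2 = -1) (hdim : finrank K V = d + 1)
    (h : IsLeonardPair A As)
    (hAW : SatisfiesAW (q ^ 2 + (q ^ 2)⁻¹) 0 0 (4 - (q ^ 2 + (q ^ 2)⁻¹) ^ 2)
      (4 - (q ^ 2 + (q ^ 2)⁻¹) ^ 2) 0 0 0 A As) :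
    ∃ k : Fin 5, PairIsomorphic A As
      (Matrix.toLin' (fivePairs d q r k).1) (Matrix.toLin' (fivePairs d q r k).2) := by
  obtain ⟨⟨d₁, b, hA, hD⟩, ⟨d₂, b', -, hT⟩⟩ := h
  obtain rfl : d = d₁ := by
    have := finrank_eq_card_basis b
    rw [hdim, Fintype.card_fin] at this
    omega
  obtain rfl : d = d₂ := by
    have := finrank_eq_card_basis b'
    rw [hdim, Fintype.card_fin] at this
    omega
  -- Apart from its dimension, the second basis enters only here, to make the eigenvalues of `As`
  -- distinct.
  have hinj := diag_injective hD hT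
  have hAs : ∀ k : Fin (d + 1), As (b k) =
      (fun z => entry (LinearMap.toMatrix b b As) z z) (k : ℕ) • b k := fun k => by
    simp only [entry_coe]
    exact apply_basis_of_isDiag hD k
  rcases Nat.eq_zero_or_pos d with hd | hd
  · exact exists_fivePairs_of_isNormalString h2 hq0 hq hr hA
      (exists_isNormalString_of_eq_zero
        (θ := fun z => entry (LinearMap.toMatrix b b As) z z) hq0 hq hr hd hA hAs hAW) hAW
  · obtain ⟨u, hu, hθ⟩ := exists_string
      (θ := fun z => entry (LinearMap.toMatrix b b As) z z) hq0 hq hd hA hAs hAW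
    have hθ' : ∀ k : Fin (d + 1), LinearMap.toMatrix b b As k k = stringSum u q (k : ℕ) :=
      fun k => by
        rw [← entry_coe (LinearMap.toMatrix b b As)]
        exact hθ k (by omega)
    obtain ⟨c, hc, hc'⟩ := exists_isNormalString_of_string (r := r) hq0 hq hr hd hu hA
      (fun k => by rw [← hθ']; exact apply_basis_of_isDiag hD k) (by simpa only [hθ'] using hinj)
      hAW
    exact exists_fivePairs_of_isNormalString h2 hq0 hq hr hc hc' hAW

end Classification

/-! ### Traces separate the five pairs -/

section Traces

open Module

variable {K : Type*} [Field K] {d : ℕ} {q r : K}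

theorem trace_toLin'_eq (N : Matrix (Fin (d + 1)) (Fin (d + 1)) K) :
    LinearMap.trace K (Fin (d + 1) → K) (Matrix.toLin' N) = N.trace := by
  rw [LinearMap.trace_eq_matrix_trace K (Pi.basisFun K (Fin (d + 1))), toMatrix_basisFun_toLin']

theorem trace_matA₁ : (matA₁ d q r).trace = 0 :=
  Finset.sum_eq_zero fun k _ => by
    rw [Matrix.diag_apply, ← entry_coe (matA₁ d q r), entry_matA₁_diag]

/-- Reversing the index negates each eigenvalue, so the trace equals its own negative. -/
theorem trace_matA₁s (h2 : (2 : K) ≠ 0) : (matA₁s d q r).trace = 0 := by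
  rw [matA₁s, Matrix.trace_diagonal]
  have h := Equiv.sum_comp Fin.revPerm fun j : Fin (d + 1) =>
    r * (q ^ ((d : ℤ) - 2 * (j : ℕ)) - q ^ (2 * (j : ℕ) - (d : ℤ)))
  have h' : ∀ j : Fin (d + 1), r * (q ^ ((d : ℤ) - 2 * (Fin.revPerm j : ℕ)) -
      q ^ (2 * (Fin.revPerm j : ℕ) - (d : ℤ))) =
      -(r * (q ^ ((d : ℤ) - 2 * (j : ℕ)) - q ^ (2 * (j : ℕ) - (d : ℤ)))) := by
    intro j
    rw [Fin.revPerm_apply, Fin.val_rev,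
      show (d : ℤ) - 2 * ((d + 1 - ((j : ℕ) + 1) : ℕ) : ℤ) = 2 * (j : ℕ) - d by omega,
      show 2 * ((d + 1 - ((j : ℕ) + 1) : ℕ) : ℤ) - (d : ℤ) = d - 2 * (j : ℕ) by omega]
    ring
  rw [Finset.sum_congr rfl fun j _ => h' j, Finset.sum_neg_distrib] at h
  refine (mul_eq_zero.mp (?_ : (2 : K) * _ = 0)).resolve_left h2
  linear_combination -h

theorem trace_matA₂ : (matA₂ d q).trace = entry (matA₂ d q) 0 0 := by
  have h0 := entry_coe (matA₂ d q) 0 0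
  simp only [Fin.val_zero, Nat.cast_zero] at h0
  rw [h0, Matrix.trace, Finset.sum_eq_single 0]
  · rfl
  · intro k _ hk
    have : (k : ℕ) ≠ 0 := fun h => hk (Fin.ext h)
    rw [Matrix.diag_apply, ← entry_coe (matA₂ d q), entry_matA₂_diag (by omega)]
  · simp

/-- Multiplication by q - q⁻¹ makes the sum telescope. Equality with the trace of `matA₂` is what
identifies the exchanged pair in the proof of self-duality. -/
theorem trace_matA₂s (hq0 : q ≠ 0) (hq : ∀ n : ℕ, 0 < n → q ^ n ≠ 1) :
    (matA₂s d q).trace = entry (matA₂ d q) 0 0 := by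
  have key : ∀ n : ℕ, (∑ j ∈ Finset.range n, (q ^ (2 * (j : ℤ) + 1) + q ^ (-2 * (j : ℤ) - 1))) *
      (q - q⁻¹) = q ^ (2 * (n : ℤ)) - q ^ (-2 * (n : ℤ)) := by
    intro n
    induction n with
    | zero => simp
    | succ n ih =>
      rw [Finset.sum_range_succ, add_mul, ih]
      push_cast
      have hN : q ^ (n : ℤ) ≠ 0 := zpow_ne_zero _ hq0
      simp only [mul_add, neg_mul, zpow_neg, zpow_sub₀ hq0, zpow_add₀ hq0, zpow_mul',
        zpow_ofNat, mul_one]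
      generalize q ^ (n : ℤ) = N at *
      field_simp
      ring
  rw [matA₂s, Matrix.trace_diagonal, entry_matA₂_zero, eq_div_iff (sub_inv_self_ne_zero hq0 hq),
    Fin.sum_univ_eq_sum_range (fun j : ℕ => q ^ (2 * (j : ℤ) + 1) + q ^ (-2 * (j : ℤ) - 1)), key]
  push_cast
  ring_nf

theorem corner_ne_zero (hq0 : q ≠ 0) (hq : ∀ n : ℕ, 0 < n → q ^ n ≠ 1) :
    entry (matA₂ d q) 0 0 ≠ 0 := by
  rw [entry_matA₂_zero]
  exact div_ne_zero (zpow_sub_zpow_ne_zero hq0 hq (by omega)) (sub_inv_self_ne_zero hq0 hq)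

theorem trace_fivePairs_fst (k : Fin 5) : (fivePairs d q r k).1.trace =
    ![0, entry (matA₂ d q) 0 0, entry (matA₂ d q) 0 0, -entry (matA₂ d q) 0 0,
      -entry (matA₂ d q) 0 0] k := by
  fin_cases k <;> simp [fivePairs, trace_matA₁, trace_matA₂, Matrix.trace_neg]

theorem trace_fivePairs_snd (h2 : (2 : K) ≠ 0) (hq0 : q ≠ 0) (hq : ∀ n : ℕ, 0 < n → q ^ n ≠ 1)
    (k : Fin 5) : (fivePairs d q r k).2.trace =
    ![0, entry (matA₂ d q) 0 0, -entry (matA₂ d q) 0 0, entry (matA₂ d q) 0 0,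
      -entry (matA₂ d q) 0 0] k := by
  fin_cases k <;> simp [fivePairs, trace_matA₁s h2, trace_matA₂s hq0 hq, Matrix.trace_neg]

/-- The traces distinguish the five pairs. -/
theorem fivePairs_eq_of_trace_eq (h2 : (2 : K) ≠ 0) (hq0 : q ≠ 0)
    (hq : ∀ n : ℕ, 0 < n → q ^ n ≠ 1) {k l : Fin 5}
    (h : (fivePairs d q r k).1.trace = (fivePairs d q r l).1.trace)
    (hs : (fivePairs d q r k).2.trace = (fivePairs d q r l).2.trace) : k = l := by
  have hT := corner_ne_zero (d := d) hq0 hq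
  have hT' : entry (matA₂ d q) 0 0 ≠ -entry (matA₂ d q) 0 0 := fun h =>
    mul_ne_zero h2 hT (by linear_combination h)
  rw [trace_fivePairs_fst, trace_fivePairs_fst] at h
  rw [trace_fivePairs_snd h2 hq0 hq, trace_fivePairs_snd h2 hq0 hq] at hs
  generalize entry (matA₂ d q) 0 0 = T at *
  fin_cases k <;> fin_cases l <;> first
    | rfl
    | exact absurd h hT'
    | exact absurd h hT'.symm
    | exact absurd hs hT'
    | exact absurd hs hT'.symm
    | exact absurd h hT
    | exact absurd h hT.symm
    | exact absurd h (neg_ne_zero.mpr hT)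
    | exact absurd h (neg_ne_zero.mpr hT).symm

theorem fivePairs_isLeonardPair (h2 : (2 : K) ≠ 0) (hq0 : q ≠ 0)
    (hq : ∀ n : ℕ, 0 < n → q ^ n ≠ 1) (hr : r ^ 2 = -1) (k : Fin 5) :
    IsLeonardPair (Matrix.toLin' (fivePairs d q r k).1) (Matrix.toLin' (fivePairs d q r k).2) := by
  have h1 := isLeonardPair_matA₁ (d := d) h2 hq0 hq hr
  have h2 := isLeonardPair_matA₂ (d := d) hq0 hq
  fin_cases k
  · exact h1
  · exact h2
  · simpa [fivePairs] using h2.neg_right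
  · simpa [fivePairs] using h2.neg_left
  · simpa [fivePairs] using h2.neg_left.neg_right

theorem fivePairs_satisfiesAW (h2 : (2 : K) ≠ 0) (hq0 : q ≠ 0)
    (hq : ∀ n : ℕ, 0 < n → q ^ n ≠ 1) (hr : r ^ 2 = -1) (k : Fin 5) :
    SatisfiesAW (q ^ 2 + (q ^ 2)⁻¹) 0 0 (4 - (q ^ 2 + (q ^ 2)⁻¹) ^ 2)
      (4 - (q ^ 2 + (q ^ 2)⁻¹) ^ 2) 0 0 0
      (Matrix.toLin' (fivePairs d q r k).1) (Matrix.toLin' (fivePairs d q r k).2) := by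
  have h1 := satisfiesAW_matA₁ (d := d) h2 hq0 hq hr
  have h2 := satisfiesAW_matA₂ (d := d) hq0 hq
  fin_cases k
  · exact h1
  · exact h2
  · have h := h2.neg_right
    rwa [← map_neg] at h
  · have h := h2.neg_left
    rwa [← map_neg] at h
  · have h := h2.neg_left.neg_right
    rwa [← map_neg, ← map_neg] at h

/-- A Leonard pair of matrices satisfying the relations is isomorphic to whichever of the five
pairs has the same traces. -/
theorem pairIsomorphic_fivePairs_of_trace (h2 : (2 : K) ≠ 0) (hq0 : q ≠ 0)
    (hq : ∀ n : ℕ, 0 < n → q ^ n ≠ 1) (hr : r ^ 2 = -1)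
    {N Ns : Matrix (Fin (d + 1)) (Fin (d + 1)) K}
    (h : IsLeonardPair (Matrix.toLin' N) (Matrix.toLin' Ns))
    (hAW : SatisfiesAW (q ^ 2 + (q ^ 2)⁻¹) 0 0 (4 - (q ^ 2 + (q ^ 2)⁻¹) ^ 2)
      (4 - (q ^ 2 + (q ^ 2)⁻¹) ^ 2) 0 0 0 (Matrix.toLin' N) (Matrix.toLin' Ns)) (l : Fin 5)
    (ht : N.trace = (fivePairs d q r l).1.trace) (hts : Ns.trace = (fivePairs d q r l).2.trace) :
    PairIsomorphic (Matrix.toLin' N) (Matrix.toLin' Ns)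
      (Matrix.toLin' (fivePairs d q r l).1) (Matrix.toLin' (fivePairs d q r l).2) := by
  obtain ⟨k, hk⟩ := exists_fivePairs (d := d) h2 hq0 hq hr (by simp) h hAW
  have e1 := hk.trace_left
  have e2 := hk.trace_right
  rw [trace_toLin'_eq, trace_toLin'_eq] at e1 e2
  obtain rfl := fivePairs_eq_of_trace_eq h2 hq0 hq (e1.symm.trans ht) (e2.symm.trans hts)
  exact hk

end Traces

theorem mainTheorem2 {K : Type*} [Field K] [IsAlgClosed K] (hchar : ringChar K ≠ 2)
    (d : ℕ) (q : K) (hq0 : q ≠ 0) (hq : ∀ n : ℕ, 0 < n → q ^ n ≠ 1)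
    (r : K) (hr : r ^ 2 = -1) (β : K) (hβ : β = q ^ 2 + (q ^ 2)⁻¹) :
    -- the five pairs are Leonard pairs
    (∀ k : Fin 5, IsLeonardPair (Matrix.toLin' (fivePairs d q r k).1)
      (Matrix.toLin' (fivePairs d q r k).2)) ∧
    -- all of them satisfy the same Askey-Wilson relations
    (∀ k : Fin 5, SatisfiesAW β 0 0 (4 - β ^ 2) (4 - β ^ 2) 0 0 0
      (Matrix.toLin' (fivePairs d q r k).1) (Matrix.toLin' (fivePairs d q r k).2)) ∧
    -- they are pairwise non-isomorphic
    (∀ k l : Fin 5, k ≠ l →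
      ¬ PairIsomorphic (Matrix.toLin' (fivePairs d q r k).1) (Matrix.toLin' (fivePairs d q r k).2)
        (Matrix.toLin' (fivePairs d q r l).1) (Matrix.toLin' (fivePairs d q r l).2)) ∧
    -- up to isomorphism they are all Leonard pairs in dimension `d + 1` with these relations
    (∀ (V : Type*) [AddCommGroup V] [Module K V] (A As : Module.End K V),
      Module.finrank K V = d + 1 → IsLeonardPair A As →
      SatisfiesAW β 0 0 (4 - β ^ 2) (4 - β ^ 2) 0 0 0 A As →
      ∃ k : Fin 5, PairIsomorphic A As
        (Matrix.toLin' (fivePairs d q r k).1) (Matrix.toLin' (fivePairs d q r k).2)) ∧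
    -- both basic pairs are self-dual
    PairIsomorphic (Matrix.toLin' (matA₁ d q r)) (Matrix.toLin' (matA₁s d q r))
      (Matrix.toLin' (matA₁s d q r)) (Matrix.toLin' (matA₁ d q r)) ∧
    PairIsomorphic (Matrix.toLin' (matA₂ d q)) (Matrix.toLin' (matA₂s d q))
      (Matrix.toLin' (matA₂s d q)) (Matrix.toLin' (matA₂ d q)) ∧
    -- the scalings of the first pair by signs are isomorphic to it
    PairIsomorphic (Matrix.toLin' (matA₁ d q r)) (Matrix.toLin' (-matA₁s d q r))
      (Matrix.toLin' (matA₁ d q r)) (Matrix.toLin' (matA₁s d q r)) ∧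
    PairIsomorphic (Matrix.toLin' (-matA₁ d q r)) (Matrix.toLin' (matA₁s d q r))
      (Matrix.toLin' (matA₁ d q r)) (Matrix.toLin' (matA₁s d q r)) ∧
    PairIsomorphic (Matrix.toLin' (-matA₁ d q r)) (Matrix.toLin' (-matA₁s d q r))
      (Matrix.toLin' (matA₁ d q r)) (Matrix.toLin' (matA₁s d q r)) := by
  subst hβ
  have h2 : (2 : K) ≠ 0 := Ring.two_ne_zero hchar
  have hL := fivePairs_isLeonardPair (d := d) h2 hq0 hq hr
  have hAW := fivePairs_satisfiesAW (d := d) h2 hq0 hq hr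
  have hL₁ : IsLeonardPair (Matrix.toLin' (matA₁ d q r)) (Matrix.toLin' (matA₁s d q r)) := hL 0
  have hAW₁ := satisfiesAW_matA₁ (d := d) h2 hq0 hq hr
  have ht₁ : (matA₁ d q r).trace = 0 := trace_matA₁
  have ht₁s : (matA₁s d q r).trace = 0 := trace_matA₁s h2
  have iso := fun {N Ns : Matrix (Fin (d + 1)) (Fin (d + 1)) K} =>
    pairIsomorphic_fivePairs_of_trace (N := N) (Ns := Ns) h2 hq0 hq hr
  refine ⟨hL, hAW, ?_, ?_, ?_, ?_, ?_, ?_, ?_⟩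
  · intro k l hkl h
    have e1 := h.trace_left
    have e2 := h.trace_right
    rw [trace_toLin'_eq, trace_toLin'_eq] at e1 e2
    exact hkl (fivePairs_eq_of_trace_eq h2 hq0 hq e1 e2)
  · intro V _ _ A As hdim h hAW
    exact exists_fivePairs h2 hq0 hq hr hdim h hAW
  -- The exchanged pair is one of the five, and both of its traces are zero.
  · exact (iso hL₁.symm hAW₁.symm 0 (ht₁s.trans ht₁.symm) (ht₁.trans ht₁s.symm)).symm
  · have ht := trace_matA₂ (d := d) (q := q)
    have hts := trace_matA₂s (d := d) hq0 hq
    exact (iso (hL 1).symm (hAW 1).symm 1 (hts.trans ht.symm) (ht.trans hts.symm)).symm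
  · refine iso (by simpa using hL₁.neg_right) (by simpa using hAW₁.neg_right) 0 rfl ?_
    exact (Matrix.trace_neg _).trans ((neg_eq_zero.mpr ht₁s).trans ht₁s.symm)
  · refine iso (by simpa using hL₁.neg_left) (by simpa using hAW₁.neg_left) 0 ?_ rfl
    exact (Matrix.trace_neg _).trans ((neg_eq_zero.mpr ht₁).trans ht₁.symm)
  · refine iso (by simpa using hL₁.neg_left.neg_right) (by simpa using hAW₁.neg_left.neg_right)
      0 ?_ ?_
    · exact (Matrix.trace_neg _).trans ((neg_eq_zero.mpr ht₁).trans ht₁.symm)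
    · exact (Matrix.trace_neg _).trans ((neg_eq_zero.mpr ht₁s).trans ht₁s.symm)
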